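/- Let $d\ge 1$ and $N\ge 0$ be integers, and let $p(z)=\sum_{|\alpha|\le N}p_\alpha z^\alpha\in\mathbb{C}[z_1,\dots,z_d]$ have total degree at most $N$, where $\alpha\in\mathbb{N}_0^d$ and $|\alpha|=\alpha_1+\dots+\alpha_d$. Let $e_j$ be the $j$-th standard unit multi-index. A $d$-tuple $T=(T_1,\dots,T_d)$ of commuting $n\times n$ complex matrices is called simple $N$-nilpotent if $\mathbb{C}^n$ is spanned by vectors $b_\alpha$ ($\alpha\in\mathbb{N}_0^d$, $|\alpha|\le N$) such that $T_jb_\alpha=b_{\alpha+e_j}$ if $|\alpha|\le N-1$ and $T_jb_\alpha=0$ if $|\alpha|=N$. A rational inner function is a rational function $\phi=Q/R$, with $Q,R\in\mathbb{C}[z_1,\dots,z_d]$, $R\ne 0$ on the open polydisk $\mathbb{D}^d$ and $|R|=|Q|$ on the torus $\mathbb{T}^d$; it maps $\mathbb{D}^d$ into the closed unit disk $\overline{\mathbb{D}}$. The following are equivalent: (1) For every $n$ and every simple $N$-nilpotent $d$-tuple $T$ of $n\times n$ matrices that are contractions for the Euclidean operator norm, $\|p(T)\|\le 1$. (2) There exist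 positive semidefinite matrices $A^1,\dots,A^d$, with rows and columns indexed by $\{\alpha\in\mathbb{N}_0^d:|\alpha|\le N\}$, such that for all $\alpha,\beta$ in this index set $$\delta_{0,\alpha,\beta}-\overline{p_\alpha}\,p_\beta=\sum_{j=1}^d\bigl(A^j_{\alpha,\beta}-A^j_{\alpha-e_j,\beta-e_j}\bigr),$$ where an entry with an index out of bounds is $0$, and $\delta_{0,\alpha,\beta}$ is $1$ if $\alpha=\beta=0$ and $0$ otherwise. (3) There exist vector-valued polynomials $A^1(z),\dots,A^d(z)$ (each with values in some $\mathbb{C}^{m_j}$) of degree at most $N$ such that $$1-|p(z)|^2=\sum_{j=1}^d(1-|z_j|^2)\,|A^j(z)|^2$$ modulo the ideal of $\mathbb{C}[z_1,\dots,z_d,\bar z_1,\dots,\bar z_d]$ generated by all $z^\alpha$ and $\bar z^\alpha$ with $|\alpha|=N+1$. (4) There exists a rational inner function $\phi:\mathbb{D}^d\to\overline{\mathbb{D}}$ such that $p-\phi$ vanishes at the origin to order at least $N+1$, and there exist positive semidefinite kernels $K_1,\dots,K_d:\mathbb{D}^d\times\mathbb{D}^d\to\mathbb{C}$ with $$1-\overline{\phi(w)}\,\phi(z)=\sum_{j=1}^d(1-\bar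 w_jz_j)K_j(z,w)\qquad(z,w\in\mathbb{D}^d).$$ -/

import Mathlib

open scoped ComplexOrder

namespace NilAgler

noncomputable section

/-- The finite set `[N]` of multi-indices `α ∈ ℕ₀ᵈ` with `|α| = ∑ⱼ αⱼ ≤ N`. -/
abbrev Idx (d N : ℕ) : Type := {α : Fin d →₀ ℕ // α.degree ≤ N}

instance instFiniteIdx (d N : ℕ) : Finite (Idx d N) :=
  (Finsupp.finite_of_degree_le (σ := Fin d) N).to_subtype

instance instFintypeIdx (d N : ℕ) : Fintype (Idx d N) := Fintype.ofFinite _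

/-- The multi-index `α - eⱼ`. It is used only when `1 ≤ αⱼ`; for `αⱼ = 0` the difference
of finitely supported functions is truncated. -/
def Idx.pred {d N : ℕ} (α : Idx d N) (j : Fin d) : Idx d N :=
  ⟨α.1 - Finsupp.single j 1, (Finsupp.degree_mono tsub_le_self).trans α.2⟩

/-- The matrix `(A_{α - eⱼ, β - eⱼ})`, an entry being `0` if an index is out of bounds. -/
def shift {d N : ℕ} (j : Fin d) (A : Matrix (Idx d N) (Idx d N) ℂ) :
    Matrix (Idx d N) (Idx d N) ℂ :=
  Matrix.of fun α β =>
    if 1 ≤ α.1 j ∧ 1 ≤ β.1 j then A (α.pred j) (β.pred j) else 0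

/-- `ℂⁿ` with its Euclidean norm. Its continuous linear endomorphisms are the `n × n` matrices,
with the operator norm. -/
abbrev Cn (n : ℕ) : Type := EuclideanSpace ℂ (Fin n)

/-- `T^α = T₁^{α₁} ⋯ T_d^{α_d}`. -/
def tuplePow {d n : ℕ} (T : Fin d → (Cn n →L[ℂ] Cn n)) (α : Fin d →₀ ℕ) : Cn n →L[ℂ] Cn n :=
  (List.ofFn fun j => T j ^ α j).prod

/-- `p(T) = ∑_α p_α T^α`. -/
def polyAt {d n : ℕ} (p : MvPolynomial (Fin d) ℂ) (T : Fin d → (Cn n →L[ℂ] Cn n)) :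
    Cn n →L[ℂ] Cn n :=
  ∑ α ∈ p.support, p.coeff α • tuplePow T α

/-- `T` is a simple `N`-nilpotent `d`-tuple of commuting `n × n` matrices. Only the vectors
`b α` with `|α| ≤ N` matter. -/
def IsSimpleNilpotent {d n : ℕ} (N : ℕ) (T : Fin d → (Cn n →L[ℂ] Cn n)) : Prop :=
  (∀ i j, Commute (T i) (T j)) ∧
  ∃ b : (Fin d →₀ ℕ) → Cn n,
    Submodule.span ℂ (b '' {α | α.degree ≤ N}) = ⊤ ∧
    (∀ j α, α.degree < N → T j (b α) = b (α + Finsupp.single j 1)) ∧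
    (∀ j α, α.degree = N → T j (b α) = 0)

/-- `ℂ[z₁,…,z_d, z̄₁,…,z̄_d]`: the variables `Sum.inl j` are the `zⱼ`, the variables `Sum.inr j`
are the `z̄ⱼ`. -/
abbrev HPoly (d : ℕ) : Type := MvPolynomial (Fin d ⊕ Fin d) ℂ

/-- `q(z)` as an element of `ℂ[z, z̄]`. -/
def holo {d : ℕ} (q : MvPolynomial (Fin d) ℂ) : HPoly d :=
  MvPolynomial.rename Sum.inl q

/-- The complex conjugate of `q(z)`, as an element of `ℂ[z, z̄]`. -/
def antiholo {d : ℕ} (q : MvPolynomial (Fin d) ℂ) : HPoly d :=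
  MvPolynomial.rename Sum.inr (MvPolynomial.map (starRingEnd ℂ) q)

/-- `|q(z)|²` as an element of `ℂ[z, z̄]`. -/
def absSq {d : ℕ} (q : MvPolynomial (Fin d) ℂ) : HPoly d :=
  holo q * antiholo q

/-- The ideal `((z)^{N+1}, (z̄)^{N+1})` of `ℂ[z, z̄]`, generated by the `z^α` and the `z̄^α`
with `|α| = N + 1`. -/
def truncIdeal (d N : ℕ) : Ideal (HPoly d) :=
  Ideal.span
    ({f | ∃ α : Fin d →₀ ℕ, α.degree = N + 1 ∧ f = holo (MvPolynomial.monomial α 1)} ∪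
     {f | ∃ α : Fin d →₀ ℕ, α.degree = N + 1 ∧ f = antiholo (MvPolynomial.monomial α 1)})

/-- The open unit polydisk `𝔻ᵈ`. -/
def polydisk (d : ℕ) : Set (Fin d → ℂ) := {z | ∀ j, ‖z j‖ < 1}

/-- The torus `𝕋ᵈ`. -/
def torus (d : ℕ) : Set (Fin d → ℂ) := {z | ∀ j, ‖z j‖ = 1}

/-- `φ` is, on `𝔻ᵈ`, a rational inner function: it maps `𝔻ᵈ` into the closed unit disk (with
values on the unit circle only for unimodular constants), and `φ = Q / R` with `R ≠ 0` on `𝔻ᵈ`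
and `|R| = |Q|` on `𝕋ᵈ`. Values of `φ` off `𝔻ᵈ` are irrelevant. -/
def IsRationalInner {d : ℕ} (φ : (Fin d → ℂ) → ℂ) : Prop :=
  (∀ z ∈ polydisk d, ‖φ z‖ ≤ 1) ∧
  ∃ Q R : MvPolynomial (Fin d) ℂ,
    (∀ z ∈ polydisk d, MvPolynomial.eval z R ≠ 0) ∧
    (∀ z ∈ torus d, ‖MvPolynomial.eval z R‖ = ‖MvPolynomial.eval z Q‖) ∧
    (∀ z ∈ polydisk d, φ z = MvPolynomial.eval z Q / MvPolynomial.eval z R)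

/-- `f` is analytic at the origin and vanishes there to order at least `m`: the homogeneous terms
of degree `< m` in its power series are zero. -/
def VanishesToOrder {d : ℕ} (m : ℕ) (f : (Fin d → ℂ) → ℂ) : Prop :=
  ∃ P : FormalMultilinearSeries ℂ (Fin d → ℂ) ℂ,
    HasFPowerSeriesAt f P 0 ∧ ∀ k < m, ∀ y : Fin d → ℂ, P k (fun _ => y) = 0

/-- `K` is a positive semidefinite kernel on `S`: all matrices `(K(xᵢ, xₖ))ᵢₖ` with points `xᵢ`
of `S` are positive semidefinite. -/
def IsPosSemidefKernel {d : ℕ} (S : Set (Fin d → ℂ)) (K : (Fin d → ℂ) → (Fin d → ℂ) → ℂ) : Prop :=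
  ∀ (m : ℕ) (x : Fin m → (Fin d → ℂ)), (∀ i, x i ∈ S) →
    (Matrix.of fun i k => K (x i) (x k)).PosSemidef

/-- `φ` has an Agler decomposition on `𝔻ᵈ`. -/
def HasAglerDecomposition {d : ℕ} (φ : (Fin d → ℂ) → ℂ) : Prop :=
  ∃ K : Fin d → (Fin d → ℂ) → (Fin d → ℂ) → ℂ,
    (∀ j, IsPosSemidefKernel (polydisk d) (K j)) ∧
    ∀ z ∈ polydisk d, ∀ w ∈ polydisk d,
      1 - starRingEnd ℂ (φ w) * φ z = ∑ j, (1 - starRingEnd ℂ (w j) * z j) * K j z w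

end

end NilAgler

/-! Everything passes through statement (2), `HasMatrixDecomposition`. Let P_j = `shiftMat d N j` be
multiplication by z_j on coefficient vectors truncated at degree N; then (2) writes the defect
matrix as ∑ (A_j - P_j A_j P_jᴴ). Since positive semidefinite matrices are Gram matrices, (3) is the
same identity read coefficient by coefficient.

(2) → (1): pairing the identity with the inner products of the vectors T^α x gives ‖x‖² - ‖p(T)x‖²
as a sum of terms ‖y‖² - ‖T_j y‖² (`norm_polyAt_le_one`).

(1) → (2): the matrices ∑ (A_j - P_j A_j P_jᴴ) form a closed convex cone. If the defect lies outside
it, a separating functional yields an inner product on truncated polynomials for which the P_j are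
contractions, yet p is longer than 1. This contradicts (1), because p(P) maps 1 to p
(`hasMatrixDecomposition_of_norm_polyAt_le_one`).

(2) → (4): a lurking isometry. Equality of two Gram matrices produces a unitary matrix, and its
transfer function is the required inner function (`exists_rationalInner`).

(4) → (2): the kernels are only positive semidefinite, with no regularity from which to take Taylor
coefficients. They are sampled on the grid ε[N] and divided differences are formed; these turn
multiplication by z_j into P_j plus a diagonal term of order ε. The compactness result
`exists_decomposition_of_tendsto` lets ε tend to 0; with ε = 0 it also shows that the cone is
closed. -/

namespace NilAgler

open Matrix Filter Topology

/-! ### Positive semidefinite matrices and the lurking isometry. -/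

section General

variable {n m : Type*} [Fintype n]

theorem exists_conjTranspose_mul_self_of_posSemidef {A : Matrix n n ℂ} (hA : A.PosSemidef) :
    ∃ B : Matrix n n ℂ, A = Bᴴ * B := by
  classical
  open scoped MatrixOrder in
  have h := (CStarAlgebra.nonneg_iff_eq_star_mul_self (a := A)).1 (Matrix.nonneg_iff_posSemidef.2 hA)
  exact h

theorem isClosed_setOf_posSemidef : IsClosed {A : Matrix n n ℂ | A.PosSemidef} := by
  have : {A : Matrix n n ℂ | A.PosSemidef} =
      {A | Aᴴ = A} ∩ ⋂ x : n → ℂ, {A | 0 ≤ star x ⬝ᵥ (A *ᵥ x)} := by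
    ext A
    simp only [Set.mem_ofPred_eq, Set.mem_inter_iff, Set.mem_iInter]
    exact Matrix.posSemidef_iff_dotProduct_mulVec
  rw [this]
  refine (isClosed_eq (by fun_prop) continuous_id).inter (isClosed_iInter fun x => ?_)
  exact isClosed_le continuous_const (by fun_prop)

theorem norm_apply_le_of_posSemidef {A : Matrix n n ℂ} (hA : A.PosSemidef) {C : ℝ}
    (hC : ∀ i, (A i i).re ≤ C) (i k : n) : ‖A i k‖ ≤ C := by
  obtain ⟨B, rfl⟩ := exists_conjTranspose_mul_self_of_posSemidef hA
  have hd : ∀ i, ((Bᴴ * B) i i).re = ∑ l, ‖B l i‖ ^ 2 := by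
    intro i
    simp only [Matrix.mul_apply, Matrix.conjTranspose_apply, Complex.re_sum]
    refine Finset.sum_congr rfl fun l _ => ?_
    rw [← Complex.normSq_eq_norm_sq, RCLike.star_def, ← Complex.normSq_eq_conj_mul_self,
      Complex.ofReal_re]
  have hb : ‖(Bᴴ * B) i k‖ ≤ ∑ l, (‖B l i‖ ^ 2 + ‖B l k‖ ^ 2) / 2 := by
    rw [Matrix.mul_apply]
    refine (norm_sum_le _ _).trans (Finset.sum_le_sum fun l _ => ?_)
    rw [norm_mul, Matrix.conjTranspose_apply, norm_star]
    nlinarith [sq_nonneg (‖B l i‖ - ‖B l k‖)]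
  rw [← Finset.sum_div, Finset.sum_add_distrib, ← hd, ← hd] at hb
  linarith [hC i, hC k]

/-- Equal Gram matrices make F x ↦ G x a well-defined isometry from the range of F. It extends to
the whole space because both ranges lie in the same finite-dimensional space. -/
theorem exists_unitary_mul_eq [DecidableEq n] [Fintype m] {F G : Matrix n m ℂ} (h : Fᴴ * F = Gᴴ * G) :
    ∃ U : Matrix n n ℂ, Uᴴ * U = 1 ∧ U * F = G := by
  classical
  let f : (m → ℂ) →ₗ[ℂ] EuclideanSpace ℂ n := (WithLp.linearEquiv 2 ℂ (n → ℂ)).symm ∘ₗ F.mulVecLin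
  let g : (m → ℂ) →ₗ[ℂ] EuclideanSpace ℂ n := (WithLp.linearEquiv 2 ℂ (n → ℂ)).symm ∘ₗ G.mulVecLin
  have hin : ∀ (M : Matrix n m ℂ) (x : m → ℂ),
      (‖WithLp.toLp 2 (M *ᵥ x)‖ : ℂ) ^ 2 = star x ⬝ᵥ ((Mᴴ * M) *ᵥ x) := by
    intro M x
    rw [← Matrix.mulVec_mulVec, Matrix.dotProduct_mulVec, ← Matrix.star_mulVec]
    have := inner_self_eq_norm_sq_to_K (𝕜 := ℂ) (WithLp.toLp 2 (M *ᵥ x))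
    rw [EuclideanSpace.inner_toLp_toLp, dotProduct_comm] at this
    exact this.symm
  have hfg : ∀ x, ‖f x‖ = ‖g x‖ := by
    intro x
    have h1 := hin F x
    rw [h, ← hin G x] at h1
    have h2 : ‖f x‖ ^ 2 = ‖g x‖ ^ 2 := by exact_mod_cast h1
    exact (pow_left_inj₀ (norm_nonneg _) (norm_nonneg _) two_ne_zero).1 h2
  have hker : LinearMap.ker f ≤ LinearMap.ker g := by
    intro x hx
    rw [LinearMap.mem_ker] at hx ⊢
    rw [← norm_eq_zero, ← hfg, hx, norm_zero]
  let q : LinearMap.range f →ₗ[ℂ] EuclideanSpace ℂ n :=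
    (LinearMap.ker f).liftQ g hker ∘ₗ f.quotKerEquivRange.symm.toLinearMap
  have hq : ∀ x, q ⟨f x, LinearMap.mem_range_self f x⟩ = g x := by
    intro x
    have : f.quotKerEquivRange.symm ⟨f x, LinearMap.mem_range_self f x⟩ =
        (LinearMap.ker f).mkQ x := by
      rw [LinearEquiv.symm_apply_eq]; rfl
    simp only [q, LinearMap.comp_apply, LinearEquiv.coe_coe, this]
    rfl
  let L : LinearMap.range f →ₗᵢ[ℂ] EuclideanSpace ℂ n := ⟨q, by
    rintro ⟨_, x, rfl⟩
    rw [hq]; exact (hfg x).symm⟩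
  let E := L.extend
  have hE : ∀ x, E (f x) = g x := fun x => by
    have := LinearIsometry.extend_apply L ⟨f x, LinearMap.mem_range_self f x⟩
    exact this.trans (hq x)
  let U : Matrix n n ℂ := Matrix.toEuclideanLin.symm E.toLinearMap
  have hU : ∀ v : n → ℂ, WithLp.toLp 2 (U *ᵥ v) = E (WithLp.toLp 2 v) := by
    intro v
    change Matrix.toEuclideanLin (Matrix.toEuclideanLin.symm E.toLinearMap) (WithLp.toLp 2 v) = _
    rw [LinearEquiv.apply_symm_apply]; rfl
  refine ⟨U, ?_, ?_⟩
  · ext i k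
    have h1 := E.inner_map_map (WithLp.toLp 2 (Pi.single i 1)) (WithLp.toLp 2 (Pi.single k 1))
    rw [← hU, ← hU, EuclideanSpace.inner_toLp_toLp, EuclideanSpace.inner_toLp_toLp] at h1
    simp only [Matrix.mulVec_single_one] at h1
    rw [Matrix.mul_apply]
    simp only [dotProduct, Matrix.col_apply, Pi.star_apply] at h1
    simp only [Matrix.conjTranspose_apply]
    simp_rw [mul_comm (star _)]
    rw [h1]
    simp [Pi.single_apply, Matrix.one_apply, apply_ite, eq_comm]
  · ext i k
    have h1 := hE (Pi.single k 1)
    have h2 : f (Pi.single k 1) = WithLp.toLp 2 (F *ᵥ Pi.single k 1) := rfl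
    have h3 : g (Pi.single k 1) = WithLp.toLp 2 (G *ᵥ Pi.single k 1) := rfl
    rw [h2, h3, ← hU, Matrix.mulVec_mulVec] at h1
    have h4 := congrArg (fun v => v.ofLp i) h1
    simpa using h4

end General

/-! ### The truncated shifts and the matrix decomposition. -/

section Shift

variable {d N : ℕ}

/-- The matrix of multiplication by `zⱼ` on polynomials truncated at degree `N`. -/
noncomputable def shiftMat (d N : ℕ) (j : Fin d) : Matrix (Idx d N) (Idx d N) ℂ :=
  Matrix.of fun α γ => open Classical in if 1 ≤ α.1 j ∧ γ = α.pred j then 1 else 0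

theorem shiftMat_mul_apply {κ : Type*} (j : Fin d) (B : Matrix (Idx d N) κ ℂ) (α : Idx d N)
    (k : κ) : (shiftMat d N j * B) α k = if 1 ≤ α.1 j then B (α.pred j) k else 0 := by
  rw [Matrix.mul_apply]
  by_cases h : 1 ≤ α.1 j <;> simp [shiftMat, h]

theorem shiftMat_mulVec (j : Fin d) (v : Idx d N → ℂ) (α : Idx d N) :
    (shiftMat d N j *ᵥ v) α = if 1 ≤ α.1 j then v (α.pred j) else 0 := by
  by_cases h : 1 ≤ α.1 j <;> simp [shiftMat, h, Matrix.mulVec, dotProduct]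

theorem shift_eq (j : Fin d) (A : Matrix (Idx d N) (Idx d N) ℂ) :
    shift j A = shiftMat d N j * A * (shiftMat d N j)ᴴ := by
  have h : ∀ α β, (shiftMat d N j * A * (shiftMat d N j)ᴴ) α β =
      star ((shiftMat d N j * (shiftMat d N j * A)ᴴ) β α) := by
    intro α β
    rw [← Matrix.conjTranspose_apply, Matrix.conjTranspose_mul, Matrix.conjTranspose_conjTranspose]
  ext α β
  rw [h, shiftMat_mul_apply, shift, Matrix.of_apply]
  by_cases hβ : 1 ≤ β.1 j
  · rw [if_pos hβ, Matrix.conjTranspose_apply, star_star, shiftMat_mul_apply]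
    simp [hβ]
  · simp [hβ]

theorem Idx.pred_add_single (α : Idx d N) (j : Fin d) (h : 1 ≤ α.1 j) :
    (α.pred j).1 + Finsupp.single j 1 = α.1 := by
  simp only [Idx.pred]
  exact tsub_add_cancel_of_le (by simpa using h)

theorem Idx.degree_pred (α : Idx d N) (j : Fin d) (h : 1 ≤ α.1 j) :
    (α.pred j).1.degree + 1 = α.1.degree := by
  rw [← α.pred_add_single j h, map_add, Finsupp.degree_single]

theorem Idx.eq_pred_iff (α γ : Idx d N) (j : Fin d) :
    (1 ≤ α.1 j ∧ γ = α.pred j) ↔ γ.1 + Finsupp.single j 1 = α.1 := by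
  constructor
  · rintro ⟨h, rfl⟩
    exact α.pred_add_single j h
  · intro h
    have h1 : 1 ≤ α.1 j := by rw [← h]; simp
    refine ⟨h1, Subtype.ext ?_⟩
    rw [← α.pred_add_single j h1] at h
    exact add_right_cancel h

theorem shiftMat_apply (j : Fin d) (α γ : Idx d N) :
    shiftMat d N j α γ =
      open Classical in if γ.1 + Finsupp.single j 1 = α.1 then 1 else 0 := by
  simp only [shiftMat, Matrix.of_apply, Idx.eq_pred_iff]

/-- Reindexing a sum of shifted coefficients against a family vanishing in degrees above `N`. -/
theorem sum_shiftMat_mulVec_smul {V : Type*} [AddCommGroup V] [Module ℂ V] (j : Fin d)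
    (v : Idx d N → ℂ) (x : (Fin d →₀ ℕ) → V) (hx : ∀ α, N < α.degree → x α = 0) :
    ∑ α : Idx d N, (shiftMat d N j *ᵥ v) α • x α.1 =
      ∑ γ : Idx d N, v γ • x (γ.1 + Finsupp.single j 1) := by
  classical
  simp only [Matrix.mulVec, dotProduct, Finset.sum_smul]
  rw [Finset.sum_comm]
  refine Finset.sum_congr rfl fun γ _ => ?_
  simp only [shiftMat_apply, ite_mul, one_mul, zero_mul, ite_smul,
    zero_smul]
  by_cases h : (γ.1 + Finsupp.single j 1).degree ≤ N
  · rw [Finset.sum_eq_single ⟨_, h⟩]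
    · simp
    · intro β _ hβ
      rw [if_neg]
      intro h'
      exact hβ (Subtype.ext h'.symm)
    · simp
  · rw [hx _ (not_le.1 h), smul_zero]
    refine Finset.sum_eq_zero fun β _ => ?_
    rw [if_neg]
    intro h'
    exact h (h' ▸ β.2)

/-- The matrix `(δ_{0,α,β} - \bar p_α p_β)`. -/
noncomputable def defect (N : ℕ) (p : MvPolynomial (Fin d) ℂ) : Matrix (Idx d N) (Idx d N) ℂ :=
  Matrix.of fun α β => (if α.1 = 0 ∧ β.1 = 0 then 1 else 0) -
    starRingEnd ℂ (p.coeff α.1) * p.coeff β.1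

/-- The defect matrix is a sum of the matrices `A - shift j A` with positive
semidefinite `A`. -/
def HasMatrixDecomposition (N : ℕ) (p : MvPolynomial (Fin d) ℂ) : Prop :=
  ∃ A : Fin d → Matrix (Idx d N) (Idx d N) ℂ, (∀ j, (A j).PosSemidef) ∧
    defect N p = ∑ j, (A j - shiftMat d N j * A j * (shiftMat d N j)ᴴ)

theorem hasMatrixDecomposition_iff (p : MvPolynomial (Fin d) ℂ) :
    HasMatrixDecomposition N p ↔
      ∃ A : Fin d → Matrix (Idx d N) (Idx d N) ℂ, (∀ j, (A j).PosSemidef) ∧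
        ∀ α β : Idx d N,
          (if α.1 = 0 ∧ β.1 = 0 then 1 else 0) - starRingEnd ℂ (p.coeff α.1) * p.coeff β.1 =
            ∑ j, (A j α β - shift j (A j) α β) := by
  refine exists_congr fun A => and_congr_right fun _ => ?_
  simp only [← shift_eq, ← Matrix.ext_iff, Matrix.sum_apply, Matrix.sub_apply]
  rfl

/-- Factoring each A_j splits it into rank-one terms; each a j k is the coefficient vector of a
polynomial. The implications from (2) to (1), (3) and (4) all start from this form. -/
theorem hasMatrixDecomposition_iff_gram (p : MvPolynomial (Fin d) ℂ) :
    HasMatrixDecomposition N p ↔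
      ∃ (m : ℕ) (a : Fin d → Fin m → Idx d N → ℂ), ∀ α β : Idx d N,
        defect N p α β = ∑ j, ∑ k, (star (a j k α) * a j k β -
          star ((shiftMat d N j *ᵥ a j k) α) * (shiftMat d N j *ᵥ a j k) β) := by
  have key : ∀ (κ : Type) [Fintype κ] (B : Fin d → Matrix (Idx d N) κ ℂ) (α β : Idx d N),
      (∑ j, (B j * (B j)ᴴ - shiftMat d N j * (B j * (B j)ᴴ) * (shiftMat d N j)ᴴ)) α β =
      ∑ j, ∑ k, (star (star (B j α k)) * star (B j β k) -
          star ((shiftMat d N j *ᵥ fun γ => star (B j γ k)) α) *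
            (shiftMat d N j *ᵥ fun γ => star (B j γ k)) β) := by
    intro κ _ B α β
    rw [Matrix.sum_apply]
    refine Finset.sum_congr rfl fun j _ => ?_
    have : shiftMat d N j * (B j * (B j)ᴴ) * (shiftMat d N j)ᴴ =
        (shiftMat d N j * B j) * (shiftMat d N j * B j)ᴴ := by
      rw [Matrix.conjTranspose_mul]; simp only [Matrix.mul_assoc]
    rw [this, Matrix.sub_apply, Matrix.mul_apply, Matrix.mul_apply, ← Finset.sum_sub_distrib]
    refine Finset.sum_congr rfl fun k _ => ?_
    simp only [Matrix.conjTranspose_apply, shiftMat_mul_apply, shiftMat_mulVec, star_star]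
    split_ifs <;> simp
  constructor
  · rintro ⟨A, hA, h⟩
    choose B hB using fun j => exists_conjTranspose_mul_self_of_posSemidef (hA j)
    let e := Fintype.equivFin (Idx d N)
    refine ⟨Fintype.card (Idx d N), fun j k γ => B j (e.symm k) γ, fun α β => ?_⟩
    have h2 := key (Fin (Fintype.card (Idx d N)))
      (fun j => Matrix.of fun γ k => star (B j (e.symm k) γ)) α β
    simp only [Matrix.of_apply, star_star] at h2
    rw [← h2, h]
    refine congrFun (congrFun ?_ α) β
    refine Finset.sum_congr rfl fun j _ => ?_
    have : A j = (Matrix.of fun γ k => star (B j (e.symm k) γ)) *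
        (Matrix.of fun γ k => star (B j (e.symm k) γ))ᴴ := by
      rw [hB j]
      ext α β
      simp only [Matrix.mul_apply, Matrix.conjTranspose_apply, Matrix.of_apply, star_star]
      exact (e.symm.sum_comp (fun l => star (B j l α) * B j l β)).symm
    rw [← this]
  · rintro ⟨m, a, h⟩
    refine ⟨fun j => (Matrix.of fun γ k => star (a j k γ)) *
      (Matrix.of fun γ k => star (a j k γ))ᴴ,
      fun j => Matrix.posSemidef_self_mul_conjTranspose _, ?_⟩
    ext α β
    rw [h, key (Fin m) (fun j => Matrix.of fun γ k => star (a j k γ)) α β]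
    simp only [Matrix.of_apply, star_star]

end Shift

/-! ### Hereditary polynomials modulo the truncation ideal. -/

section Polynomials

variable {d N : ℕ}

theorem coeff_X_mul_eq_shiftMat_mulVec (j : Fin d) (q : MvPolynomial (Fin d) ℂ) (α : Idx d N) :
    (MvPolynomial.X j * q).coeff α.1 =
      (shiftMat d N j *ᵥ fun γ : Idx d N => q.coeff γ.1) α := by
  classical
  rw [MvPolynomial.coeff_X_mul', shiftMat_mulVec]
  simp [Idx.pred, Nat.one_le_iff_ne_zero]

theorem sumElim_eq_mapDomain_add_mapDomain (α β : Fin d →₀ ℕ) :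
    α.sumElim β = α.mapDomain Sum.inl + β.mapDomain Sum.inr := by
  ext (i | i)
  · rw [Finsupp.add_apply, Finsupp.mapDomain_apply Sum.inl_injective,
      Finsupp.mapDomain_of_notMem_range _ _ (by simp)]
    simp
  · rw [Finsupp.add_apply, Finsupp.mapDomain_apply Sum.inr_injective,
      Finsupp.mapDomain_of_notMem_range _ _ (by simp)]
    simp

theorem exists_eq_sumElim (γ : Fin d ⊕ Fin d →₀ ℕ) : ∃ α β, γ = Finsupp.sumElim α β := by
  refine ⟨γ.comapDomain Sum.inl Sum.inl_injective.injOn,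
    γ.comapDomain Sum.inr Sum.inr_injective.injOn, ?_⟩
  ext (i | i) <;> simp

theorem sumElim_inj {α β α' β' : Fin d →₀ ℕ} :
    α.sumElim β = α'.sumElim β' ↔ α = α' ∧ β = β' := by
  refine ⟨fun h => ⟨?_, ?_⟩, fun h => by rw [h.1, h.2]⟩
  · ext i; simpa using DFunLike.congr_fun h (Sum.inl i)
  · ext i; simpa using DFunLike.congr_fun h (Sum.inr i)

theorem sumElim_le_sumElim {α β α' β' : Fin d →₀ ℕ} :
    α.sumElim β ≤ α'.sumElim β' ↔ α ≤ α' ∧ β ≤ β' := by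
  refine ⟨fun h => ⟨fun i => ?_, fun i => ?_⟩, ?_⟩
  · simpa using h (Sum.inl i)
  · simpa using h (Sum.inr i)
  · rintro ⟨h1, h2⟩ (i | i)
    · simpa using h1 i
    · simpa using h2 i

theorem coeff_holo_mul_antiholo (q r : MvPolynomial (Fin d) ℂ) (α β : Fin d →₀ ℕ) :
    (holo q * antiholo r).coeff (α.sumElim β) = q.coeff α * starRingEnd ℂ (r.coeff β) := by
  classical
  induction q using MvPolynomial.induction_on' with
  | add q₁ q₂ h₁ h₂ =>
    rw [MvPolynomial.coeff_add, add_mul, ← h₁, ← h₂, ← MvPolynomial.coeff_add, ← add_mul]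
    simp [holo]
  | monomial α' a =>
    induction r using MvPolynomial.induction_on' with
    | add r₁ r₂ h₁ h₂ =>
      rw [MvPolynomial.coeff_add, map_add, mul_add, ← h₁, ← h₂, ← MvPolynomial.coeff_add,
        ← mul_add]
      simp [antiholo]
    | monomial β' b =>
      rw [holo, antiholo, MvPolynomial.map_monomial, MvPolynomial.rename_monomial,
        MvPolynomial.rename_monomial, MvPolynomial.monomial_mul,
        ← sumElim_eq_mapDomain_add_mapDomain, MvPolynomial.coeff_monomial,
        MvPolynomial.coeff_monomial, MvPolynomial.coeff_monomial]
      by_cases h1 : α' = α <;> by_cases h2 : β' = β <;> simp [sumElim_inj, h1, h2]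

/-- The ideal is monomial, so membership is tested on each monomial; z^α z̄^β is divisible by a
generator exactly when |α| > N or |β| > N. -/
theorem mem_truncIdeal_iff (f : HPoly d) :
    f ∈ truncIdeal d N ↔ ∀ α β : Idx d N, f.coeff (α.1.sumElim β.1) = 0 := by
  have hs : truncIdeal d N = Ideal.span ((fun s => MvPolynomial.monomial s (1 : ℂ)) ''
      {s | ∃ α : Fin d →₀ ℕ, α.degree = N + 1 ∧ (s = α.sumElim 0 ∨ s = Finsupp.sumElim 0 α)}) := by
    rw [truncIdeal]
    congr 1
    ext f
    simp only [Set.mem_union, Set.mem_ofPred_eq, Set.mem_image, holo, antiholo,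
      MvPolynomial.map_monomial, MvPolynomial.rename_monomial, map_one,
      sumElim_eq_mapDomain_add_mapDomain, Finsupp.mapDomain_zero, add_zero, zero_add]
    constructor
    · rintro (⟨α, h, rfl⟩ | ⟨α, h, rfl⟩)
      · exact ⟨_, ⟨α, h, Or.inl rfl⟩, rfl⟩
      · exact ⟨_, ⟨α, h, Or.inr rfl⟩, rfl⟩
    · rintro ⟨_, ⟨α, h, rfl | rfl⟩, rfl⟩
      · exact Or.inl ⟨α, h, rfl⟩
      · exact Or.inr ⟨α, h, rfl⟩
  rw [hs, MvPolynomial.mem_ideal_span_monomial_image]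
  constructor
  · intro h α β
    by_contra hne
    obtain ⟨s, ⟨γ, hγ, hs⟩, hle⟩ := h _ (MvPolynomial.mem_support_iff.2 hne)
    have hα := α.2
    have hβ := β.2
    rcases hs with rfl | rfl
    · have := Finsupp.degree_mono (sumElim_le_sumElim.1 hle).1
      omega
    · have := Finsupp.degree_mono (sumElim_le_sumElim.1 hle).2
      omega
  · intro h s hs
    obtain ⟨α, β, rfl⟩ := exists_eq_sumElim s
    by_cases hα : α.degree ≤ N
    · by_cases hβ : β.degree ≤ N
      · exact absurd (h ⟨α, hα⟩ ⟨β, hβ⟩) (MvPolynomial.mem_support_iff.1 hs)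
      · obtain ⟨γ, hγ, hd⟩ := Finsupp.exists_le_degree_eq β (N + 1) (by omega)
        exact ⟨_, ⟨γ, hd, Or.inr rfl⟩, sumElim_le_sumElim.2 ⟨zero_le, hγ⟩⟩
    · obtain ⟨γ, hγ, hd⟩ := Finsupp.exists_le_degree_eq α (N + 1) (by omega)
      exact ⟨_, ⟨γ, hd, Or.inl rfl⟩, sumElim_le_sumElim.2 ⟨hγ, zero_le⟩⟩

theorem absSq_mul (q r : MvPolynomial (Fin d) ℂ) : absSq (q * r) = absSq q * absSq r := by
  simp only [absSq, holo, antiholo, map_mul]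
  ring

/-- The row index α is the exponent of z̄ and the column index β that of z, hence the swap in
`sumElim`. -/
theorem coeff_absSq (q : MvPolynomial (Fin d) ℂ) (α β : Fin d →₀ ℕ) :
    (absSq q).coeff (β.sumElim α) = star (q.coeff α) * q.coeff β := by
  rw [absSq, coeff_holo_mul_antiholo, mul_comm]
  rfl

theorem coeff_one_sub_absSq (p : MvPolynomial (Fin d) ℂ) (α β : Idx d N) :
    (1 - absSq p).coeff (β.1.sumElim α.1) = defect N p α β := by
  classical
  rw [MvPolynomial.coeff_sub, coeff_absSq, MvPolynomial.coeff_one, defect, Matrix.of_apply]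
  congr 1
  have : (0 : Fin d ⊕ Fin d →₀ ℕ) = Finsupp.sumElim 0 0 := by simp
  rw [this]
  simp only [sumElim_inj]
  congr 1
  simp only [eq_comm, and_comm]

theorem coeff_one_sub_absSq_X_mul (j : Fin d) (q : MvPolynomial (Fin d) ℂ) (α β : Idx d N) :
    ((1 - absSq (MvPolynomial.X j)) * absSq q).coeff (β.1.sumElim α.1) =
      star (q.coeff α.1) * q.coeff β.1 -
        star ((shiftMat d N j *ᵥ fun γ : Idx d N => q.coeff γ.1) α) *
          (shiftMat d N j *ᵥ fun γ : Idx d N => q.coeff γ.1) β := by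
  rw [sub_mul, one_mul, ← absSq_mul, MvPolynomial.coeff_sub, coeff_absSq, coeff_absSq,
    coeff_X_mul_eq_shiftMat_mulVec, coeff_X_mul_eq_shiftMat_mulVec]

theorem coeff_sum_monomial (a : Idx d N → ℂ) (β : Idx d N) :
    (∑ α : Idx d N, MvPolynomial.monomial α.1 (a α)).coeff β.1 = a β := by
  classical
  rw [MvPolynomial.coeff_sum, Finset.sum_eq_single β]
  · simp
  · intro α _ h
    rw [MvPolynomial.coeff_monomial, if_neg]
    exact fun h' => h (Subtype.ext h')
  · simp

theorem totalDegree_sum_monomial_le (a : Idx d N → ℂ) :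
    (∑ α : Idx d N, MvPolynomial.monomial α.1 (a α)).totalDegree ≤ N :=
  MvPolynomial.totalDegree_finsetSum_le fun α _ =>
    (MvPolynomial.totalDegree_monomial_le _ _).trans (by
      have := α.2
      rwa [Finsupp.degree_apply] at this)

theorem shift_vecMulVec_star_self (j : Fin d) (v : Idx d N → ℂ) (α β : Idx d N) :
    (shiftMat d N j * Matrix.vecMulVec (star v) v * (shiftMat d N j)ᴴ) α β =
      star ((shiftMat d N j *ᵥ v) α) * (shiftMat d N j *ᵥ v) β := by
  rw [← shift_eq, shift, Matrix.of_apply, shiftMat_mulVec, shiftMat_mulVec]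
  by_cases h1 : 1 ≤ α.1 j <;> by_cases h2 : 1 ≤ β.1 j <;> simp [h1, h2, Matrix.vecMulVec_apply]

theorem hasMatrixDecomposition_iff_mem_truncIdeal (p : MvPolynomial (Fin d) ℂ) :
    HasMatrixDecomposition N p ↔
      ∃ (m : Fin d → ℕ) (A : (j : Fin d) → Fin (m j) → MvPolynomial (Fin d) ℂ),
        (∀ j k, (A j k).totalDegree ≤ N) ∧
        (1 - absSq p) - ∑ j, (1 - absSq (MvPolynomial.X j)) * ∑ k, absSq (A j k) ∈
          truncIdeal d N := by
  have key : ∀ (m : Fin d → ℕ) (A : (j : Fin d) → Fin (m j) → MvPolynomial (Fin d) ℂ),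
      (1 - absSq p) - ∑ j, (1 - absSq (MvPolynomial.X j)) * ∑ k, absSq (A j k) ∈
          truncIdeal d N ↔ ∀ α β : Idx d N, defect N p α β = ∑ j, ∑ k,
            (star ((A j k).coeff α.1) * (A j k).coeff β.1 -
        star ((shiftMat d N j *ᵥ fun γ : Idx d N => (A j k).coeff γ.1) α) *
          (shiftMat d N j *ᵥ fun γ : Idx d N => (A j k).coeff γ.1) β) := by
    intro m A
    rw [mem_truncIdeal_iff, forall_comm]
    refine forall₂_congr fun α β => ?_
    rw [MvPolynomial.coeff_sub, coeff_one_sub_absSq, MvPolynomial.coeff_sum, sub_eq_zero]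
    simp only [Finset.mul_sum, MvPolynomial.coeff_sum, coeff_one_sub_absSq_X_mul]
  constructor
  · rw [hasMatrixDecomposition_iff_gram]
    rintro ⟨m, a, h⟩
    refine ⟨fun _ => m, fun j k => ∑ α : Idx d N, MvPolynomial.monomial α.1 (a j k α),
      fun j k => totalDegree_sum_monomial_le _, ?_⟩
    rw [key]
    simpa only [coeff_sum_monomial] using h
  · rintro ⟨m, A, -, h⟩
    rw [key] at h
    -- Here the number of components may depend on j, whereas `hasMatrixDecomposition_iff_gram` uses
    -- a single m; the Gram matrices are therefore assembled directly.
    refine ⟨fun j => ∑ k, Matrix.vecMulVec (star fun γ : Idx d N => (A j k).coeff γ.1)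
      (fun γ : Idx d N => (A j k).coeff γ.1),
      fun j => Matrix.posSemidef_sum _ fun k _ => Matrix.posSemidef_vecMulVec_star_self _, ?_⟩
    ext α β
    rw [h, Matrix.sum_apply]
    refine Finset.sum_congr rfl fun j _ => ?_
    rw [Finset.mul_sum, Finset.sum_mul, ← Finset.sum_sub_distrib, Matrix.sum_apply]
    refine Finset.sum_congr rfl fun k _ => ?_
    exact congrArg₂ _ rfl (shift_vecMulVec_star_self j _ α β).symm

end Polynomials

/-! ### Simple nilpotent tuples of contractions. -/

section Tuples

variable {d N n : ℕ}

theorem multiIndex_induction {P : (Fin d →₀ ℕ) → Prop} (zero : P 0)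
    (add : ∀ α j, P α → P (α + Finsupp.single j 1)) (α : Fin d →₀ ℕ) : P α := by
  induction h : α.degree generalizing α with
  | zero =>
    rw [Finsupp.degree_eq_zero_iff] at h
    exact h ▸ zero
  | succ k ih =>
    obtain ⟨j, hj⟩ : ∃ j, α j ≠ 0 := by
      by_contra! h0
      have : α = 0 := Finsupp.ext h0
      simp [this] at h
    have hle : Finsupp.single j 1 ≤ α := by simpa [Nat.one_le_iff_ne_zero] using hj
    have heq := tsub_add_cancel_of_le hle
    rw [← heq]
    refine add _ _ (ih _ ?_)
    rw [← heq, map_add, Finsupp.degree_single] at h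
    omega

theorem tuplePow_zero (T : Fin d → (Cn n →L[ℂ] Cn n)) : tuplePow T 0 = 1 := by
  simp [tuplePow, List.ofFn_const]

/-- The submonoid generated by the T_j is commutative, so the ordered product can be rearranged
there. -/
theorem tuplePow_add_single {T : Fin d → (Cn n →L[ℂ] Cn n)} (hT : ∀ i j, Commute (T i) (T j))
    (α : Fin d →₀ ℕ) (j : Fin d) :
    tuplePow T (α + Finsupp.single j 1) = T j * tuplePow T α := by
  classical
  let S := Submonoid.closure (Set.range T)
  have hS : IsMulCommutative S := Submonoid.isMulCommutative_closure _ (by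
    rintro _ ⟨i, rfl⟩ _ ⟨k, rfl⟩
    exact hT i k)
  let _ : CommMonoid S := { (inferInstance : Monoid S) with mul_comm := hS.is_comm.comm }
  let t : Fin d → S := fun i => ⟨T i, Submonoid.subset_closure ⟨i, rfl⟩⟩
  have h : ∀ β : Fin d →₀ ℕ, tuplePow T β = ((∏ i, t i ^ β i : S) : Cn n →L[ℂ] Cn n) := by
    intro β
    rw [← List.prod_ofFn, tuplePow]
    refine Eq.trans ?_ (map_list_prod S.subtype _).symm
    rw [List.map_ofFn]
    rfl
  have h2 : (∏ i, t i ^ (α + Finsupp.single j 1 : Fin d →₀ ℕ) i) = t j * ∏ i, t i ^ α i := by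
    simp only [Finsupp.add_apply, pow_add, Finset.prod_mul_distrib]
    rw [mul_comm]
    congr 1
    rw [Finset.prod_eq_single j]
    · simp
    · intro i _ hi
      simp [hi.symm]
    · simp
  rw [h, h, h2]
  rfl

theorem tuplePow_apply_of_simple {T : Fin d → (Cn n →L[ℂ] Cn n)}
    (hT : ∀ i j, Commute (T i) (T j)) {b : (Fin d →₀ ℕ) → Cn n}
    (hb : ∀ j α, α.degree < N → T j (b α) = b (α + Finsupp.single j 1))
    (hb0 : ∀ j α, α.degree = N → T j (b α) = 0) (α β : Fin d →₀ ℕ) (hβ : β.degree ≤ N) :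
    tuplePow T α (b β) = if α.degree + β.degree ≤ N then b (α + β) else 0 := by
  induction α using multiIndex_induction with
  | zero => simp [tuplePow_zero, hβ]
  | add α j ih =>
    rw [tuplePow_add_single hT, mul_apply_eq_comp, ih, map_add, Finsupp.degree_single]
    by_cases h1 : α.degree + β.degree ≤ N
    · rw [if_pos h1]
      by_cases h2 : α.degree + β.degree = N
      · rw [if_neg (by omega), hb0]
        rwa [map_add]
      · rw [if_pos (by omega), hb _ _ (by rw [map_add]; omega)]
        congr 1
        abel
    · rw [if_neg h1, if_neg (by omega), map_zero]

theorem tuplePow_eq_zero {T : Fin d → (Cn n →L[ℂ] Cn n)} (hT : IsSimpleNilpotent N T)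
    {α : Fin d →₀ ℕ} (hα : N < α.degree) : tuplePow T α = 0 := by
  obtain ⟨hc, b, hs, hb, hb0⟩ := hT
  have h : (tuplePow T α : Cn n →ₗ[ℂ] Cn n) = 0 := by
    refine LinearMap.ext_on hs ?_
    rintro _ ⟨β, hβ, rfl⟩
    have := tuplePow_apply_of_simple hc hb hb0 α β hβ
    rw [if_neg (by omega)] at this
    simpa using this
  ext1 x
  exact LinearMap.congr_fun h x

theorem sum_support_smul {V : Type*} [AddCommGroup V] [Module ℂ V] {p : MvPolynomial (Fin d) ℂ}
    (hp : p.totalDegree ≤ N) (g : (Fin d →₀ ℕ) → V) :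
    ∑ α ∈ p.support, p.coeff α • g α = ∑ α : Idx d N, p.coeff α.1 • g α.1 := by
  classical
  have h := Finset.sum_map Finset.univ (Function.Embedding.subtype _ : Idx d N ↪ (Fin d →₀ ℕ))
    fun α => p.coeff α • g α
  refine Eq.trans ?_ h
  refine Finset.sum_subset (fun α hα => ?_) fun α _ hα => ?_
  · have : α.degree ≤ N := by
      rw [Finsupp.degree_apply]
      exact (MvPolynomial.le_totalDegree hα).trans hp
    exact Finset.mem_map.2 ⟨⟨α, this⟩, Finset.mem_univ _, rfl⟩
  · rw [MvPolynomial.notMem_support_iff.1 hα, zero_smul]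

theorem polyAt_apply {p : MvPolynomial (Fin d) ℂ} (hp : p.totalDegree ≤ N)
    (T : Fin d → (Cn n →L[ℂ] Cn n)) (x : Cn n) :
    polyAt p T x = ∑ α : Idx d N, p.coeff α.1 • tuplePow T α.1 x := by
  rw [← sum_support_smul hp (fun α => tuplePow T α x), polyAt]
  simp

theorem sum_sum_mul_inner {ι V : Type*} [Fintype ι] [NormedAddCommGroup V] [InnerProductSpace ℂ V]
    (u v : ι → ℂ) (x : ι → V) :
    ∑ α, ∑ β, star (u α) * v β * inner ℂ (x α) (x β) =
      inner ℂ (∑ α, u α • x α) (∑ β, v β • x β) := by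
  rw [sum_inner]
  refine Finset.sum_congr rfl fun α _ => ?_
  rw [inner_smul_left, inner_sum, Finset.mul_sum]
  refine Finset.sum_congr rfl fun β _ => ?_
  rw [inner_smul_right, mul_assoc]
  rfl

/-- Pairing the (α, β) entry with ⟪T^α x, T^β x⟫ turns the defect into ‖x‖² - ‖p(T)x‖², and each a j
k into ‖y‖² - ‖T_j y‖² with y = ∑ a_α T^α x. -/
theorem norm_polyAt_le_one {p : MvPolynomial (Fin d) ℂ} (hp : p.totalDegree ≤ N)
    (h : HasMatrixDecomposition N p) {T : Fin d → (Cn n →L[ℂ] Cn n)} (hT : IsSimpleNilpotent N T)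
    (hT1 : ∀ j, ‖T j‖ ≤ 1) : ‖polyAt p T‖ ≤ 1 := by
  classical
  obtain ⟨m, a, ha⟩ := (hasMatrixDecomposition_iff_gram p).1 h
  refine ContinuousLinearMap.opNorm_le_bound _ zero_le_one fun x => ?_
  rw [one_mul]
  let X : (Fin d →₀ ℕ) → Cn n := fun α => tuplePow T α x
  let y : Fin d → Fin m → Cn n := fun j k => ∑ α : Idx d N, a j k α • X α.1
  -- Truncation costs nothing: the terms dropped by `shiftMat` carry T^α with |α| > N, which is
  -- zero.
  have hshift : ∀ j k, ∑ α : Idx d N, (shiftMat d N j *ᵥ a j k) α • X α.1 = T j (y j k) := by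
    intro j k
    rw [sum_shiftMat_mulVec_smul j _ X]
    · simp only [y, map_sum, map_smul, X, tuplePow_add_single hT.1, mul_apply_eq_comp]
    · intro α hα
      simp only [X, tuplePow_eq_zero hT hα, _root_.zero_apply]
  have h0 : ∑ α : Idx d N, (if α.1 = 0 then (1 : ℂ) else 0) • X α.1 = x := by
    rw [Finset.sum_eq_single ⟨0, by simp⟩]
    · simp [X, tuplePow_zero]
    · intro α _ hα
      rw [if_neg (fun h => hα (Subtype.ext h)), zero_smul]
    · simp
  have e1 : ∑ α : Idx d N, ∑ β : Idx d N, defect N p α β * inner ℂ (X α.1) (X β.1) =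
      inner ℂ x x - inner ℂ (polyAt p T x) (polyAt p T x) := by
    have hxx := sum_sum_mul_inner (fun α : Idx d N => if α.1 = 0 then (1 : ℂ) else 0)
      (fun α : Idx d N => if α.1 = 0 then (1 : ℂ) else 0) (fun α => X α.1)
    rw [h0] at hxx
    rw [polyAt_apply hp, ← sum_sum_mul_inner, ← hxx]
    simp only [← Finset.sum_sub_distrib]
    refine Finset.sum_congr rfl fun α _ => Finset.sum_congr rfl fun β _ => ?_
    rw [← sub_mul, defect, Matrix.of_apply]
    congr 2
    by_cases h1 : α.1 = 0 <;> by_cases h2 : β.1 = 0 <;> simp [h1, h2]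
  have e2 : ∑ α : Idx d N, ∑ β : Idx d N, defect N p α β * inner ℂ (X α.1) (X β.1) =
      ∑ j, ∑ k, (inner ℂ (y j k) (y j k) - inner ℂ (T j (y j k)) (T j (y j k))) := by
    simp only [ha, Finset.sum_mul, ← hshift]
    simp only [y, ← sum_sum_mul_inner, ← Finset.sum_sub_distrib]
    rw [Finset.sum_congr rfl fun α _ => Finset.sum_comm, Finset.sum_comm]
    refine Finset.sum_congr rfl fun j _ => ?_
    rw [Finset.sum_congr rfl fun α _ => Finset.sum_comm, Finset.sum_comm]
    refine Finset.sum_congr rfl fun k _ => Finset.sum_congr rfl fun α _ =>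
      Finset.sum_congr rfl fun β _ => ?_
    rw [sub_mul]
  have e3 : ‖x‖ ^ 2 - ‖polyAt p T x‖ ^ 2 = ∑ j, ∑ k, (‖y j k‖ ^ 2 - ‖T j (y j k)‖ ^ 2) := by
    have := e1.symm.trans e2
    simp only [inner_self_eq_norm_sq_to_K] at this
    exact_mod_cast this
  have e4 : 0 ≤ ∑ j, ∑ k, (‖y j k‖ ^ 2 - ‖T j (y j k)‖ ^ 2) := by
    refine Finset.sum_nonneg fun j _ => Finset.sum_nonneg fun k _ => ?_
    rw [sub_nonneg]
    gcongr
    simpa using (T j).le_of_opNorm_le (hT1 j) (y j k)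
  refine le_of_sq_le_sq ?_ (norm_nonneg _)
  linarith

theorem exists_linearEquiv_of_posDef {ι : Type*} [Fintype ι] {G : Matrix ι ι ℂ} (hG : G.PosDef) :
    ∃ J : (ι → ℂ) ≃ₗ[ℂ] Cn (Fintype.card ι),
      ∀ v, ‖J v‖ ^ 2 = (star v ⬝ᵥ (G *ᵥ v)).re := by
  classical
  obtain ⟨S, rfl⟩ := exists_conjTranspose_mul_self_of_posSemidef hG.posSemidef
  have hS : IsUnit S := isUnit_of_mul_isUnit_right hG.isUnit
  have := hS.invertible
  let J₁ : (ι → ℂ) ≃ₗ[ℂ] (ι → ℂ) := Matrix.toLin'OfInv (invOf_mul_self S) (mul_invOf_self S)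
  let e := LinearIsometryEquiv.piLpCongrLeft 2 ℂ ℂ (Fintype.equivFin ι)
  refine ⟨J₁ ≪≫ₗ (WithLp.linearEquiv 2 ℂ (ι → ℂ)).symm ≪≫ₗ e.toLinearEquiv, fun v => ?_⟩
  have h1 : ‖e (WithLp.toLp 2 (S *ᵥ v))‖ = ‖WithLp.toLp 2 (S *ᵥ v)‖ := e.norm_map _
  have h2 := inner_self_eq_norm_sq_to_K (𝕜 := ℂ) (WithLp.toLp 2 (S *ᵥ v))
  rw [EuclideanSpace.inner_toLp_toLp, dotProduct_comm] at h2
  have h3 : J₁ v = S *ᵥ v := Matrix.toLin'_apply S v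
  change ‖e (WithLp.toLp 2 (J₁ v))‖ ^ 2 = _
  rw [h3, h1, ← Matrix.mulVec_mulVec, Matrix.dotProduct_mulVec, ← Matrix.star_mulVec, h2]
  simp only [Complex.coe_algebraMap]
  norm_cast

/-- Every vector is the truncation of a polynomial, on which the shifts act as multiplication by
variables. -/
theorem shiftMat_mulVec_comm (i j : Fin d) (v : Idx d N → ℂ) :
    shiftMat d N i *ᵥ (shiftMat d N j *ᵥ v) = shiftMat d N j *ᵥ (shiftMat d N i *ᵥ v) := by
  obtain ⟨q, rfl⟩ : ∃ q : MvPolynomial (Fin d) ℂ, v = fun γ : Idx d N => q.coeff γ.1 :=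
    ⟨_, funext fun β => (coeff_sum_monomial v β).symm⟩
  have h : ∀ (j : Fin d) (q : MvPolynomial (Fin d) ℂ),
      (shiftMat d N j *ᵥ fun γ : Idx d N => q.coeff γ.1) =
        fun γ : Idx d N => (MvPolynomial.X j * q).coeff γ.1 := fun j q =>
    funext fun α => (coeff_X_mul_eq_shiftMat_mulVec j q α).symm
  rw [h, h, h, h, mul_left_comm]

/-- With the inner product G, truncated polynomials carry a contractive simple N-nilpotent tuple:
T_j multiplies by z_j and b_α = z^α. As p(T) maps 1 to p, the hypothesis bounds the G-norm of p by
that of 1. -/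
theorem quadraticForm_coeff_le {p : MvPolynomial (Fin d) ℂ} (hp : p.totalDegree ≤ N)
    (h : ∀ (n : ℕ) (T : Fin d → (Cn n →L[ℂ] Cn n)),
        IsSimpleNilpotent N T → (∀ j, ‖T j‖ ≤ 1) → ‖polyAt p T‖ ≤ 1)
    {G : Matrix (Idx d N) (Idx d N) ℂ} (hG : G.PosDef)
    (hGP : ∀ j v, (star (shiftMat d N j *ᵥ v) ⬝ᵥ (G *ᵥ (shiftMat d N j *ᵥ v))).re ≤
      (star v ⬝ᵥ (G *ᵥ v)).re) :
    (star (fun α : Idx d N => p.coeff α.1) ⬝ᵥ (G *ᵥ fun α : Idx d N => p.coeff α.1)).re ≤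
      (G ⟨0, by simp⟩ ⟨0, by simp⟩).re := by
  classical
  obtain ⟨J, hJ⟩ := exists_linearEquiv_of_posDef hG
  let T : Fin d → (Cn (Fintype.card (Idx d N)) →L[ℂ] Cn (Fintype.card (Idx d N))) := fun j =>
    LinearMap.toContinuousLinearMap (J.toLinearMap ∘ₗ (shiftMat d N j).mulVecLin ∘ₗ
      J.symm.toLinearMap)
  have hTJ : ∀ j v, T j (J v) = J (shiftMat d N j *ᵥ v) := by
    intro j v
    simp [T]
  let b : (Fin d →₀ ℕ) → Cn (Fintype.card (Idx d N)) := fun α =>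
    if hα : α.degree ≤ N then J (Pi.single ⟨α, hα⟩ 1) else 0
  have hbs : ∀ α : Idx d N, b α.1 = J (Pi.single α 1) := fun α => dif_pos α.2
  have hb : ∀ j α, α.degree < N → T j (b α) = b (α + Finsupp.single j 1) := by
    intro j α hα
    have h1 : (α + Finsupp.single j 1).degree ≤ N := by
      rw [map_add, Finsupp.degree_single]; omega
    rw [hbs ⟨α, hα.le⟩, hbs ⟨_, h1⟩, hTJ]
    congr 1
    ext β
    simp only [Matrix.mulVec_single_one, Matrix.col_apply, shiftMat_apply, Pi.single_apply,
      Subtype.ext_iff, eq_comm]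
  have hb0 : ∀ j α, α.degree = N → T j (b α) = 0 := by
    intro j α hα
    rw [hbs ⟨α, hα.le⟩, hTJ]
    rw [← map_zero J]
    congr 1
    ext β
    simp only [Matrix.mulVec_single_one, Matrix.col_apply, shiftMat_apply, Pi.zero_apply]
    rw [if_neg]
    intro h'
    have := β.2
    rw [← h', map_add, Finsupp.degree_single] at this
    omega
  have hc : ∀ i j, Commute (T i) (T j) := by
    intro i j
    ext1 x
    obtain ⟨v, rfl⟩ := J.surjective x
    rw [mul_apply_eq_comp, mul_apply_eq_comp, hTJ, hTJ, hTJ, hTJ,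
      shiftMat_mulVec_comm]
  have hspan : Submodule.span ℂ (b '' {α | α.degree ≤ N}) = ⊤ := by
    have : b '' {α | α.degree ≤ N} = J '' Set.range (fun α : Idx d N => Pi.single α (1 : ℂ)) := by
      ext x
      constructor
      · rintro ⟨α, hα, rfl⟩
        exact ⟨_, ⟨⟨α, hα⟩, rfl⟩, (hbs ⟨α, hα⟩).symm⟩
      · rintro ⟨_, ⟨α, rfl⟩, rfl⟩
        exact ⟨α.1, α.2, hbs α⟩
    have h2 : (fun α : Idx d N => Pi.single α (1 : ℂ)) = Pi.basisFun ℂ (Idx d N) := by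
      ext1 α
      simp
    rw [this, h2, ← LinearEquiv.coe_coe, ← Submodule.map_span, Module.Basis.span_eq,
      Submodule.map_top, LinearEquiv.range]
  have hT1 : ∀ j, ‖T j‖ ≤ 1 := by
    intro j
    refine ContinuousLinearMap.opNorm_le_bound _ zero_le_one fun x => ?_
    obtain ⟨v, rfl⟩ := J.surjective x
    rw [one_mul, hTJ]
    refine le_of_sq_le_sq ?_ (norm_nonneg _)
    rw [hJ, hJ]
    exact hGP j v
  have hnorm := (polyAt p T).le_of_opNorm_le
    (h _ T ⟨hc, b, hspan, hb, hb0⟩ hT1) (b 0)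
  rw [one_mul, polyAt_apply hp] at hnorm
  have hpow : ∀ α : Idx d N, tuplePow T α.1 (b 0) = J (Pi.single α 1) := by
    intro α
    rw [tuplePow_apply_of_simple hc hb hb0 α.1 0 (by simp), if_pos (by simpa using α.2), add_zero,
      hbs]
  simp only [hpow] at hnorm
  rw [hbs ⟨0, by simp⟩] at hnorm
  have hsum : ∑ α : Idx d N, p.coeff α.1 • J (Pi.single α 1) = J fun α : Idx d N => p.coeff α.1 := by
    simp only [← map_smul, ← map_sum]
    congr 1
    exact (pi_eq_sum_univ' _).symm
  rw [hsum] at hnorm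
  have := pow_le_pow_left₀ (norm_nonneg _) hnorm 2
  rw [hJ, hJ] at this
  refine this.trans (le_of_eq ?_)
  simp [Pi.star_single]

end Tuples

/-! ### Compactness of decompositions under perturbed shifts. -/

section Compactness

variable {d N : ℕ}

/-- The parallelogram law, with the nonnegative term from X - Y discarded. -/
theorem re_add_mul_mul_conjTranspose_le {ι κ : Type*} [Fintype ι] [Finite κ] {A : Matrix ι ι ℂ}
    (hA : A.PosSemidef) (X Y : Matrix κ ι ℂ) (i : κ) :
    (((X + Y) * A * (X + Y)ᴴ) i i).re ≤ 2 * ((X * A * Xᴴ) i i).re + 2 * ((Y * A * Yᴴ) i i).re := by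
  have h : (X - Y) * A * (X - Y)ᴴ =
      (2 : ℂ) • (X * A * Xᴴ) + (2 : ℂ) • (Y * A * Yᴴ) - (X + Y) * A * (X + Y)ᴴ := by
    simp only [Matrix.conjTranspose_sub, Matrix.conjTranspose_add, Matrix.sub_mul, Matrix.mul_sub,
      Matrix.add_mul, Matrix.mul_add, two_smul]
    abel
  have h2 := (hA.mul_mul_conjTranspose_same (X - Y)).diag_nonneg (i := i)
  rw [h] at h2
  have h3 := (Complex.le_def.1 h2).1
  simp only [Matrix.sub_apply, Matrix.add_apply, Matrix.smul_apply, smul_eq_mul, Complex.sub_re,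
    Complex.add_re, Complex.mul_re, Complex.re_ofNat, Complex.im_ofNat, Complex.zero_re] at h3
  linarith

/-- Multiplication by `zⱼ` in the Newton basis of the grid of step `ε`. -/
noncomputable def gridShift (d N : ℕ) (ε : ℝ) (j : Fin d) : Matrix (Idx d N) (Idx d N) ℂ :=
  open Classical in shiftMat d N j + (ε : ℂ) • Matrix.diagonal fun α : Idx d N => (α.1 j : ℂ)

theorem Idx.apply_le (α : Idx d N) (j : Fin d) : α.1 j ≤ N :=
  (Finsupp.le_degree j α.1).trans α.2

theorem re_gridShift_le {A : Matrix (Idx d N) (Idx d N) ℂ} (hA : A.PosSemidef) (ε : ℝ) (j : Fin d)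
    (α : Idx d N) {C : ℝ} (hC0 : 0 ≤ C) (hC : 1 ≤ α.1 j → (A (α.pred j) (α.pred j)).re ≤ C) :
    ((gridShift d N ε j * A * (gridShift d N ε j)ᴴ) α α).re ≤
      2 * C + 2 * (ε * N) ^ 2 * (A α α).re := by
  classical
  refine (re_add_mul_mul_conjTranspose_le hA _ _ α).trans (add_le_add ?_ ?_)
  · rw [← shift_eq, shift, Matrix.of_apply]
    by_cases h : 1 ≤ α.1 j
    · simpa [h] using hC h
    · simpa [h] using hC0
  · have h0 : 0 ≤ (A α α).re := (Complex.le_def.1 (hA.diag_nonneg (i := α))).1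
    have h1 : ((((ε : ℂ) • Matrix.diagonal fun α : Idx d N => (α.1 j : ℂ)) * A *
        ((ε : ℂ) • Matrix.diagonal fun α : Idx d N => (α.1 j : ℂ))ᴴ) α α).re =
        (ε * α.1 j) ^ 2 * (A α α).re := by
      rw [Matrix.conjTranspose_smul, Matrix.diagonal_conjTranspose, Matrix.smul_mul,
        Matrix.smul_mul, Matrix.mul_smul, Matrix.smul_apply, Matrix.smul_apply,
        Matrix.mul_diagonal, Matrix.diagonal_mul]
      have : (ε : ℂ) • star (ε : ℂ) • ((α.1 j : ℂ) * A α α * (star fun α : Idx d N => (α.1 j : ℂ)) α)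
          = (((ε * α.1 j) ^ 2 : ℝ) : ℂ) * A α α := by
        simp
        ring
      rw [this, Complex.re_ofReal_mul]
    rw [h1]
    have h2 : (ε * α.1 j) ^ 2 ≤ (ε * N) ^ 2 := by
      rw [mul_pow, mul_pow]
      have : (α.1 j : ℝ) ≤ N := by exact_mod_cast α.apply_le j
      gcongr
    nlinarith

/-- Induction on the degree. On the diagonal, ∑_j A_j(α,α) equals M(α,α) plus terms controlled by
entries of lower degree, plus a multiple of A_j(α,α) that is absorbed on the left once ε is small.
-/
theorem exists_eventually_re_diag_le {A : ℕ → Fin d → Matrix (Idx d N) (Idx d N) ℂ}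
    (hA : ∀ k j, (A k j).PosSemidef) {ε : ℕ → ℝ} (hε : Tendsto ε atTop (𝓝 0))
    {M : ℕ → Matrix (Idx d N) (Idx d N) ℂ} {M₀ : Matrix (Idx d N) (Idx d N) ℂ}
    (hM : Tendsto M atTop (𝓝 M₀))
    (h : ∀ k, M k = ∑ j, (A k j - gridShift d N (ε k) j * A k j * (gridShift d N (ε k) j)ᴴ))
    (n : ℕ) : ∃ C : ℝ, 0 ≤ C ∧ ∀ᶠ k in atTop, ∀ j (α : Idx d N), α.1.degree < n →
      (A k j α α).re ≤ C := by
  induction n with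
  | zero => exact ⟨0, le_rfl, by simp⟩
  | succ n ih =>
    obtain ⟨C, hC0, hC⟩ := ih
    have hM' : ∀ᶠ k in atTop, ∀ α : Idx d N, (M k α α).re < ∑ α, ‖M₀ α α‖ + 1 := by
      refine eventually_all.2 fun α => ?_
      have h1 : Tendsto (fun k => (M k α α).re) atTop (𝓝 (M₀ α α).re) :=
        (Complex.continuous_re.tendsto _).comp
          (((continuous_id.matrix_elem α α).tendsto M₀).comp hM)
      refine h1.eventually_lt_const ?_
      have h2 := Finset.single_le_sum (f := fun α => ‖M₀ α α‖) (fun _ _ => norm_nonneg _)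
        (Finset.mem_univ α)
      have h3 := Complex.re_le_norm (M₀ α α)
      linarith
    set K := ∑ α, ‖M₀ α α‖ + 1 with hK
    have hK0 : 0 ≤ K := by positivity
    -- The bound 1/4 makes the factor 2(εN)² of `re_gridShift_le` less than 1/2.
    have hε' : ∀ᶠ k in atTop, (ε k * N) ^ 2 < 1 / 4 := by
      have h1 : Tendsto (fun k => (ε k * N) ^ 2) atTop (𝓝 ((0 * N) ^ 2)) :=
        (hε.mul_const _).pow 2
      exact h1.eventually_lt_const (by norm_num)
    -- With S = ∑_j A_j(α,α), the estimates give S ≤ K + 2dC + S/2.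
    refine ⟨2 * K + 4 * d * C, by positivity, ?_⟩
    filter_upwards [hC, hM', hε'] with k hCk hMk hεk i α hα
    have h0 : ∀ j, 0 ≤ (A k j α α).re := fun j =>
      (Complex.le_def.1 ((hA k j).diag_nonneg (i := α))).1
    have h1 : ∀ j, ((gridShift d N (ε k) j * A k j * (gridShift d N (ε k) j)ᴴ) α α).re ≤
        2 * C + 1 / 2 * (A k j α α).re := by
      intro j
      refine (re_gridShift_le (hA k j) (ε k) j α hC0 fun hj => hCk j _ ?_).trans ?_
      · have := α.degree_pred j hj
        omega
      · nlinarith [h0 j]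
    have h2 := congrArg Complex.re (congrFun (congrFun (h k) α) α)
    rw [Matrix.sum_apply, Complex.re_sum] at h2
    simp only [Matrix.sub_apply, Complex.sub_re] at h2
    rw [Finset.sum_sub_distrib] at h2
    have h3 := Finset.sum_le_sum fun j (_ : j ∈ Finset.univ) => h1 j
    rw [Finset.sum_add_distrib, Finset.sum_const, ← Finset.mul_sum] at h3
    simp only [Finset.card_univ, Fintype.card_fin, nsmul_eq_mul] at h3
    have h4 : (A k i α α).re ≤ ∑ j, (A k j α α).re :=
      Finset.single_le_sum (f := fun j => (A k j α α).re) (fun j _ => h0 j) (Finset.mem_univ i)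
    have := hMk α
    linarith

theorem tendsto_gridShift {ε : ℕ → ℝ} (hε : Tendsto ε atTop (𝓝 0)) (j : Fin d) :
    Tendsto (fun k => gridShift d N (ε k) j) atTop (𝓝 (shiftMat d N j)) := by
  classical
  have h : Continuous fun t : ℝ => gridShift d N t j := by
    unfold gridShift
    fun_prop
  have h2 := (h.tendsto 0).comp hε
  simpa [gridShift, Function.comp_def] using h2

/-- Compactness of the set of decompositions. -/
theorem exists_decomposition_of_tendsto {A : ℕ → Fin d → Matrix (Idx d N) (Idx d N) ℂ}
    (hA : ∀ k j, (A k j).PosSemidef) {ε : ℕ → ℝ} (hε : Tendsto ε atTop (𝓝 0))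
    {M : ℕ → Matrix (Idx d N) (Idx d N) ℂ} {M₀ : Matrix (Idx d N) (Idx d N) ℂ}
    (hM : Tendsto M atTop (𝓝 M₀))
    (h : ∀ k, M k = ∑ j, (A k j - gridShift d N (ε k) j * A k j * (gridShift d N (ε k) j)ᴴ)) :
    ∃ B : Fin d → Matrix (Idx d N) (Idx d N) ℂ, (∀ j, (B j).PosSemidef) ∧
      M₀ = ∑ j, (B j - shiftMat d N j * B j * (shiftMat d N j)ᴴ) := by
  -- The strict bound |α| < N + 1 covers all of [N]; bounded diagonals then bound every entry.
  obtain ⟨C, hC0, hC⟩ := exists_eventually_re_diag_le hA hε hM h (N + 1)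
  let A' : ℕ → Fin d → Idx d N → Idx d N → ℂ := fun k j α β => A k j α β
  have hb : ∃ᶠ k in atTop, A' k ∈
      Metric.closedBall (0 : Fin d → Idx d N → Idx d N → ℂ) C := by
    refine Eventually.frequently ?_
    filter_upwards [hC] with k hk
    rw [mem_closedBall_zero_iff, pi_norm_le_iff_of_nonneg hC0]
    intro j
    rw [pi_norm_le_iff_of_nonneg hC0]
    intro α
    rw [pi_norm_le_iff_of_nonneg hC0]
    intro β
    exact norm_apply_le_of_posSemidef (hA k j) (fun γ => hk j γ (Nat.lt_succ_of_le γ.2)) α β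
  obtain ⟨B, -, φ, hφ, hB⟩ := tendsto_subseq_of_frequently_bounded Metric.isBounded_closedBall hb
  have hBj : ∀ j, Tendsto (fun k => A (φ k) j) atTop (𝓝 (Matrix.of (B j))) := fun j =>
    (tendsto_pi_nhds.1 hB) j
  refine ⟨fun j => Matrix.of (B j), fun j => ?_, ?_⟩
  · exact isClosed_setOf_posSemidef.mem_of_tendsto (hBj j)
      (Eventually.of_forall fun k => hA (φ k) j)
  · refine tendsto_nhds_unique (hM.comp hφ.tendsto_atTop) ?_
    simp only [Function.comp_def, h]
    refine tendsto_finsetSum _ fun j _ => ?_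
    have hS := tendsto_gridShift (N := N) (hε.comp hφ.tendsto_atTop) j
    have hSt : Tendsto (fun k => (gridShift d N (ε (φ k)) j)ᴴ) atTop (𝓝 (shiftMat d N j)ᴴ) :=
      (continuous_id.matrix_conjTranspose.tendsto _).comp hS
    exact (hBj j).sub ((hS.mul (hBj j)).mul hSt)

end Compactness

/-! ### Separating the defect from the cone. -/

section Separation

variable {d N : ℕ}

/-- The cone of the sums of matrices `A - shift j A` with positive semidefinite `A`. -/
def aglerCone (d N : ℕ) : Set (Matrix (Idx d N) (Idx d N) ℂ) :=
  {M | ∃ A : Fin d → Matrix (Idx d N) (Idx d N) ℂ, (∀ j, (A j).PosSemidef) ∧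
    M = ∑ j, (A j - shiftMat d N j * A j * (shiftMat d N j)ᴴ)}

theorem isClosed_aglerCone : IsClosed (aglerCone d N) := by
  have : FirstCountableTopology (Matrix (Idx d N) (Idx d N) ℂ) :=
    inferInstanceAs (FirstCountableTopology (Idx d N → Idx d N → ℂ))
  refine IsSeqClosed.isClosed fun M M₀ hM hM₀ => ?_
  choose A hA h using hM
  refine exists_decomposition_of_tendsto (ε := fun _ => 0) hA tendsto_const_nhds hM₀ fun k => ?_
  rw [h]
  simp [gridShift]

theorem add_mem_aglerCone {M M' : Matrix (Idx d N) (Idx d N) ℂ} (hM : M ∈ aglerCone d N)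
    (hM' : M' ∈ aglerCone d N) : M + M' ∈ aglerCone d N := by
  obtain ⟨A, hA, rfl⟩ := hM
  obtain ⟨B, hB, rfl⟩ := hM'
  refine ⟨A + B, fun j => (hA j).add (hB j), ?_⟩
  rw [← Finset.sum_add_distrib]
  refine Finset.sum_congr rfl fun j _ => ?_
  simp only [Pi.add_apply, Matrix.mul_add, Matrix.add_mul]
  abel

theorem smul_mem_aglerCone {M : Matrix (Idx d N) (Idx d N) ℂ} (hM : M ∈ aglerCone d N) {t : ℝ}
    (ht : 0 ≤ t) : t • M ∈ aglerCone d N := by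
  obtain ⟨A, hA, rfl⟩ := hM
  refine ⟨t • A, fun j => ?_, ?_⟩
  · have := (hA j).smul (a := (t : ℂ)) (by exact_mod_cast ht)
    convert this using 1
    ext α β
    simp
  · rw [Finset.smul_sum]
    refine Finset.sum_congr rfl fun j _ => ?_
    simp only [Pi.smul_apply, Matrix.mul_smul, Matrix.smul_mul, smul_sub]

theorem convex_aglerCone : Convex ℝ (aglerCone d N) := fun _ hM _ hM' _ _ ha hb _ =>
  add_mem_aglerCone (smul_mem_aglerCone hM ha) (smul_mem_aglerCone hM' hb)

theorem sub_shift_mem_aglerCone {A : Matrix (Idx d N) (Idx d N) ℂ} (hA : A.PosSemidef)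
    (j : Fin d) : A - shiftMat d N j * A * (shiftMat d N j)ᴴ ∈ aglerCone d N := by
  classical
  refine ⟨Pi.single j A, fun i => ?_, ?_⟩
  · by_cases h : i = j
    · subst h; simpa using hA
    · simpa [h] using Matrix.PosSemidef.zero
  · rw [Finset.sum_eq_single j]
    · simp
    · intro i _ hi
      simp [hi]
    · simp

theorem pow_shiftMat_mulVec_apply (j : Fin d) (v : Idx d N → ℂ) (k : ℕ) (α : Idx d N)
    (hα : α.1.degree < k) : ((shiftMat d N j ^ k) *ᵥ v) α = 0 := by
  classical
  induction k generalizing α with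
  | zero => omega
  | succ k ih =>
    rw [pow_succ', ← Matrix.mulVec_mulVec, shiftMat_mulVec]
    split_ifs with h
    · refine ih _ ?_
      have := α.degree_pred j h
      omega
    · rfl

theorem re_star_dotProduct_self {ι : Type*} [Fintype ι] (v : ι → ℂ) :
    (star v ⬝ᵥ v).re = ∑ i, ‖v i‖ ^ 2 := by
  rw [dotProduct, Complex.re_sum]
  refine Finset.sum_congr rfl fun l _ => ?_
  rw [← Complex.normSq_eq_norm_sq, Pi.star_apply, RCLike.star_def,
    ← Complex.normSq_eq_conj_mul_self, Complex.ofReal_re]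

/-- This keeps the shifts contractive when a multiple of the Euclidean form is added to q below. -/
theorem sum_norm_sq_shiftMat_mulVec_le (j : Fin d) (v : Idx d N → ℂ) :
    ∑ α, ‖(shiftMat d N j *ᵥ v) α‖ ^ 2 ≤ ∑ α, ‖v α‖ ^ 2 := by
  classical
  have h := sum_shiftMat_mulVec_smul j (fun γ => ((‖v γ‖ ^ 2 : ℝ) : ℂ))
    (fun α => if α.degree ≤ N then (1 : ℂ) else 0) (fun α hα => if_neg (not_le.2 hα))
  have h1 : ∀ α : Idx d N, (shiftMat d N j *ᵥ fun γ => ((‖v γ‖ ^ 2 : ℝ) : ℂ)) α =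
      ((‖(shiftMat d N j *ᵥ v) α‖ ^ 2 : ℝ) : ℂ) := by
    intro α
    rw [shiftMat_mulVec, shiftMat_mulVec]
    split_ifs <;> simp
  have h2 := congrArg Complex.re h
  simp only [h1, Complex.re_sum, smul_eq_mul, Complex.re_ofReal_mul] at h2
  have h3 : ∑ α, ‖(shiftMat d N j *ᵥ v) α‖ ^ 2 = _ :=
    (Finset.sum_congr rfl fun α _ => by rw [if_pos α.2, Complex.one_re, mul_one]).trans h2
  rw [h3]
  refine Finset.sum_le_sum fun α _ => ?_
  split_ifs <;> simp

theorem hasMatrixDecomposition_of_norm_polyAt_le_one (hd : 1 ≤ d) {p : MvPolynomial (Fin d) ℂ}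
    (hp : p.totalDegree ≤ N)
    (h : ∀ (n : ℕ) (T : Fin d → (Cn n →L[ℂ] Cn n)),
        IsSimpleNilpotent N T → (∀ j, ‖T j‖ ≤ 1) → ‖polyAt p T‖ ≤ 1) :
    HasMatrixDecomposition N p := by
  classical
  by_contra hcon
  have hM : defect N p ∉ aglerCone d N := hcon
  have : LocallyConvexSpace ℝ (Matrix (Idx d N) (Idx d N) ℂ) :=
    inferInstanceAs (LocallyConvexSpace ℝ (Idx d N → Idx d N → ℂ))
  obtain ⟨f, u, hfu, hu⟩ := RCLike.geometric_hahn_banach_closed_point (𝕜 := ℂ)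
    convex_aglerCone isClosed_aglerCone hM
  have hu0 : 0 < u := by
    have h0 := smul_mem_aglerCone
      (sub_shift_mem_aglerCone (N := N) Matrix.PosSemidef.zero ⟨0, hd⟩) (t := 0) le_rfl
    simpa using hfu _ h0
  -- A functional bounded above on a cone is nonpositive there: otherwise a could be rescaled to
  -- have real part exactly u.
  have hf : ∀ a ∈ aglerCone d N, (f a).re ≤ 0 := by
    intro a ha
    by_contra! hpos
    have h1 := hfu _ (smul_mem_aglerCone ha (t := u / (f a).re) (by positivity))
    have h2 : f ((u / (f a).re) • a) = ((u / (f a).re : ℝ) : ℂ) * f a := by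
      rw [← smul_eq_mul, ← map_smul]
      rfl
    rw [h2] at h1
    simp only [RCLike.re_to_complex, Complex.re_ofReal_mul] at h1
    rw [div_mul_cancel₀ _ hpos.ne'] at h1
    exact lt_irrefl _ h1
  let q : (Idx d N → ℂ) → ℝ := fun v => -(f (Matrix.vecMulVec (star v) v)).re
  have hqP : ∀ j v, q (shiftMat d N j *ᵥ v) ≤ q v := by
    intro j v
    have h1 := hf _ (sub_shift_mem_aglerCone (Matrix.posSemidef_vecMulVec_star_self v) j)
    have h2 : shiftMat d N j * Matrix.vecMulVec (star v) v * (shiftMat d N j)ᴴ =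
        Matrix.vecMulVec (star (shiftMat d N j *ᵥ v)) (shiftMat d N j *ᵥ v) := by
      ext α β
      rw [shift_vecMulVec_star_self, Matrix.vecMulVec_apply, Pi.star_apply]
    rw [h2, map_sub, Complex.sub_re] at h1
    simp only [q]
    linarith
  -- Iterating q(P v) ≤ q(v) with a nilpotent shift P gives 0 = q(P^(N+1) v) ≤ q(v).
  have hq0 : ∀ v, 0 ≤ q v := by
    intro v
    have h1 : ∀ k, q ((shiftMat d N ⟨0, hd⟩ ^ k) *ᵥ v) ≤ q v := by
      intro k
      induction k with
      | zero => simp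
      | succ k ih =>
        rw [pow_succ', ← Matrix.mulVec_mulVec]
        exact (hqP _ _).trans ih
    have h2 : (shiftMat d N ⟨0, hd⟩ ^ (N + 1)) *ᵥ v = 0 :=
      funext fun α => pow_shiftMat_mulVec_apply _ _ _ _ (Nat.lt_succ_of_le α.2)
    have h3 := h1 (N + 1)
    rw [h2] at h3
    simpa [q] using h3
  let F : Matrix (Idx d N) (Idx d N) ℂ := Matrix.of fun α β => f (Matrix.single α β 1)
  have hfF : ∀ v, f (Matrix.vecMulVec (star v) v) = star v ⬝ᵥ (F *ᵥ v) := by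
    intro v
    rw [Matrix.matrix_eq_sum_single (Matrix.vecMulVec (star v) v)]
    simp only [map_sum, dotProduct, Matrix.mulVec, Finset.mul_sum]
    refine Finset.sum_congr rfl fun α _ => Finset.sum_congr rfl fun β _ => ?_
    have : Matrix.single α β (Matrix.vecMulVec (star v) v α β) =
        (star v α * v β) • Matrix.single α β (1 : ℂ) := by
      rw [Matrix.smul_single, smul_eq_mul, mul_one, Matrix.vecMulVec_apply]
    rw [this, map_smul, smul_eq_mul]
    simp only [F, Matrix.of_apply]
    ring
  let p' : Idx d N → ℂ := fun α => p.coeff α.1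
  let e₀ : Idx d N := ⟨0, by simp⟩
  have hdef : defect N p = Matrix.vecMulVec (star (Pi.single e₀ (1 : ℂ))) (Pi.single e₀ 1) -
      Matrix.vecMulVec (star p') p' := by
    ext α β
    rw [defect, Matrix.of_apply, Matrix.sub_apply, Matrix.vecMulVec_apply, Matrix.vecMulVec_apply]
    congr 1
    have h1 : ∀ α : Idx d N, α = e₀ ↔ α.1 = 0 := fun α => Subtype.ext_iff
    rw [Pi.star_apply, Pi.single_apply, Pi.single_apply]
    by_cases h2 : α.1 = 0 <;> by_cases h3 : β.1 = 0 <;> simp [h1, h2, h3]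
  have hqp : q (Pi.single e₀ 1) < q p' := by
    rw [hdef, map_sub] at hu
    simp only [RCLike.re_to_complex, Complex.sub_re] at hu
    simp only [q]
    linarith
  -- Half the gap, so that q(1) + δ is still less than q(p).
  set δ := (q p' - q (Pi.single e₀ 1)) / 2 with hδ
  have hδ0 : 0 < δ := by rw [hδ]; linarith
  -- The Hermitian part of -F represents q; adding δ times the identity makes it positive definite.
  let G : Matrix (Idx d N) (Idx d N) ℂ := -((2⁻¹ : ℂ) • (F + Fᴴ)) + (δ : ℂ) • 1
  have hG : ∀ v, star v ⬝ᵥ (G *ᵥ v) = ((q v + δ * ∑ i, ‖v i‖ ^ 2 : ℝ) : ℂ) := by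
    intro v
    have h1 : star v ⬝ᵥ (Fᴴ *ᵥ v) = star (star v ⬝ᵥ (F *ᵥ v)) := by
      rw [Matrix.star_dotProduct, Matrix.star_mulVec, Matrix.conjTranspose_conjTranspose,
        ← Matrix.dotProduct_mulVec]
    have h2 : star v ⬝ᵥ v = ((∑ i, ‖v i‖ ^ 2 : ℝ) : ℂ) := by
      apply Complex.ext
      · rw [re_star_dotProduct_self, Complex.ofReal_re]
      · rw [Complex.ofReal_im]
        exact (Complex.le_def.1 (dotProduct_star_self_nonneg v)).2.symm
    simp only [G, Matrix.add_mulVec, Matrix.neg_mulVec, Matrix.smul_mulVec, Matrix.one_mulVec,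
      dotProduct_add, dotProduct_neg, dotProduct_smul, h1, h2, ← hfF, q]
    rw [RCLike.star_def, Complex.add_conj]
    push_cast
    simp
  have hGH : G.IsHermitian := by
    simp only [G, Matrix.IsHermitian, Matrix.conjTranspose_add, Matrix.conjTranspose_neg,
      Matrix.conjTranspose_smul, Matrix.conjTranspose_conjTranspose, Matrix.conjTranspose_one]
    rw [add_comm Fᴴ F]
    simp
  have hGpos : G.PosDef := by
    refine Matrix.PosDef.of_dotProduct_mulVec_pos hGH fun v hv => ?_
    rw [hG]
    have h1 : 0 < ∑ i, ‖v i‖ ^ 2 := by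
      obtain ⟨i, hi⟩ := Function.ne_iff.1 hv
      exact Finset.sum_pos' (fun _ _ => by positivity)
        ⟨i, Finset.mem_univ _, by have := norm_pos_iff.2 hi; positivity⟩
    have h2 := hq0 v
    have h3 : 0 < q v + δ * ∑ i, ‖v i‖ ^ 2 := by positivity
    exact_mod_cast h3
  have hfin := quadraticForm_coeff_le hp h hGpos fun j v => by
    rw [hG, hG, Complex.ofReal_re, Complex.ofReal_re]
    have := sum_norm_sq_shiftMat_mulVec_le j v
    have := hqP j v
    gcongr
  have he : (G e₀ e₀).re = q (Pi.single e₀ 1) + δ := by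
    have h1 := congrArg Complex.re (hG (Pi.single e₀ 1))
    rw [Complex.ofReal_re] at h1
    have h2 : ∑ i, ‖(Pi.single e₀ 1 : Idx d N → ℂ) i‖ ^ 2 = 1 := by
      rw [Finset.sum_eq_single e₀]
      · simp
      · intro i _ hi
        simp [hi]
      · simp
    rw [h2, mul_one] at h1
    rw [← h1]
    simp [Pi.star_single]
  rw [hG, Complex.ofReal_re] at hfin
  change q p' + δ * ∑ i, ‖p' i‖ ^ 2 ≤ (G e₀ e₀).re at hfin
  rw [he] at hfin
  have : 0 ≤ δ * ∑ i, ‖p' i‖ ^ 2 := by positivity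
  linarith

end Separation

/-! ### Order of vanishing as a growth estimate. -/

section VanishingOrder

variable {d : ℕ}

theorem VanishesToOrder.isBigO {m : ℕ} {f : (Fin d → ℂ) → ℂ} (h : VanishesToOrder m f) :
    f =O[𝓝 0] fun z => ‖z‖ ^ m := by
  obtain ⟨P, hP, h0⟩ := h
  have h1 := hP.isBigO_sub_partialSum_pow m
  refine h1.congr_left fun y => ?_
  rw [FormalMultilinearSeries.partialSum, Finset.sum_eq_zero, sub_zero, zero_add]
  exact fun k hk => h0 k (Finset.mem_range.1 hk) y

/-- Once the lower terms are zero, the homogeneous term of degree k < m is O(‖z‖^(k+1)), hence zero.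
-/
theorem vanishesToOrder_of_isBigO {m : ℕ} {f : (Fin d → ℂ) → ℂ} (hf : AnalyticAt ℂ f 0)
    (h : f =O[𝓝 0] fun z => ‖z‖ ^ m) : VanishesToOrder m f := by
  obtain ⟨P, hP⟩ := hf
  refine ⟨P, hP, fun k => ?_⟩
  induction k using Nat.strong_induction_on with
  | _ k ih =>
    intro hk
    refine Asymptotics.IsBigO.continuousMultilinearMap_apply_eq_zero ?_
    have h1 := hP.isBigO_sub_partialSum_pow (k + 1)
    have h2 : f =O[𝓝 0] fun z => ‖z‖ ^ (k + 1) := by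
      refine h.trans ?_
      refine Asymptotics.IsBigO.of_bound 1 ?_
      filter_upwards [Metric.closedBall_mem_nhds (0 : Fin d → ℂ) one_pos] with z hz
      rw [mem_closedBall_zero_iff] at hz
      simp only [norm_pow, norm_norm, one_mul]
      exact pow_le_pow_of_le_one (norm_nonneg _) hz hk
    refine (h2.sub h1).congr_left fun y => ?_
    rw [FormalMultilinearSeries.partialSum, Finset.sum_range_succ, Finset.sum_eq_zero, zero_add,
      zero_add, sub_sub_cancel]
    exact fun i hi => ih i (Finset.mem_range.1 hi) ((Finset.mem_range.1 hi).trans hk) y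

end VanishingOrder

/-! ### Divided differences in one variable. -/

section DividedDifferences

open scoped Nat

variable {d N : ℕ}

/-- The coefficient of `f g` in the divided difference of `f` at the nodes `0, 1, …, b`. -/
noncomputable def divDiffCoeff (b g : ℕ) : ℂ :=
  if g ≤ b then (-1) ^ (b - g) / (g ! * (b - g)!) else 0

theorem star_divDiffCoeff (b g : ℕ) : star (divDiffCoeff b g) = divDiffCoeff b g := by
  unfold divDiffCoeff
  split_ifs <;> simp

/-- The Leibniz rule: the divided difference of (x - b) f at 0, …, b is that of f at 0, …, b - 1. -/
theorem divDiffCoeff_mul_sub (b g : ℕ) :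
    divDiffCoeff b g * (g - b) = if 1 ≤ b then divDiffCoeff (b - 1) g else 0 := by
  unfold divDiffCoeff
  rcases lt_trichotomy g b with h | rfl | h
  · obtain ⟨k, rfl⟩ := Nat.exists_eq_add_of_lt h
    have h1 : g + k + 1 - g = k + 1 := by omega
    have h2 : g + k + 1 - 1 - g = k := by omega
    have hk : (k ! : ℂ) ≠ 0 := by exact_mod_cast k.factorial_ne_zero
    have hg : (g ! : ℂ) ≠ 0 := by exact_mod_cast g.factorial_ne_zero
    have hk1 : (k + 1 : ℂ) ≠ 0 := by exact_mod_cast k.succ_ne_zero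
    rw [if_pos h.le, if_pos (by omega), if_pos (by omega), h1, h2, Nat.factorial_succ]
    push_cast
    field_simp
    ring
  · by_cases h1 : 1 ≤ g
    · simp [h1, show ¬ g ≤ g - 1 by omega]
    · simp [h1]
  · rw [if_neg (by omega), zero_mul]
    split_ifs <;> first | rfl | omega

/-- The divided differences of the constant 1, by the binomial expansion of (1 - 1)^b / b!. -/
theorem sum_divDiffCoeff {b n : ℕ} (h : b ≤ n) :
    ∑ g ∈ Finset.range (n + 1), divDiffCoeff b g = if b = 0 then 1 else 0 := by
  have h1 : ∑ g ∈ Finset.range (b + 1), divDiffCoeff b g =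
      ∑ g ∈ Finset.range (n + 1), divDiffCoeff b g := by
    refine Finset.sum_subset (Finset.range_subset_range.2 (by omega)) fun g _ hg => ?_
    rw [divDiffCoeff, if_neg]
    simpa [Nat.lt_succ_iff] using hg
  have h2 := add_pow (1 : ℂ) (-1) b
  have hb : (b ! : ℂ) ≠ 0 := by exact_mod_cast b.factorial_ne_zero
  have h3 : ∑ g ∈ Finset.range (b + 1), divDiffCoeff b g = (1 + -1 : ℂ) ^ b / b ! := by
    rw [h2, Finset.sum_div]
    refine Finset.sum_congr rfl fun g hg => ?_
    have hgb : g ≤ b := Nat.lt_succ_iff.1 (Finset.mem_range.1 hg)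
    rw [divDiffCoeff, if_pos hgb, Nat.cast_choose ℂ hgb, one_pow, one_mul]
    field_simp
  rw [← h1, h3]
  by_cases h0 : b = 0 <;> simp [h0]

end DividedDifferences

/-! ### From kernels on a grid to coefficient matrices. -/

section Grid

variable {d N : ℕ}

/-- The point `ε γ` of the grid of step `ε`. -/
noncomputable def gridPoint (ε : ℝ) (γ : Idx d N) : Fin d → ℂ := fun j => ε * γ.1 j

/-- The matrix of the divided differences on the grid of step `ε`. -/
noncomputable def gridDiff (d N : ℕ) (ε : ℝ) : Matrix (Idx d N) (Idx d N) ℂ :=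
  Matrix.of fun β γ => ((ε : ℂ) ^ β.1.degree)⁻¹ * ∏ j, divDiffCoeff (β.1 j) (γ.1 j)

theorem gridDiff_conjTranspose (ε : ℝ) : (gridDiff d N ε)ᴴ = (gridDiff d N ε)ᵀ := by
  ext β γ
  simp only [gridDiff, Matrix.conjTranspose_apply, Matrix.transpose_apply, Matrix.of_apply,
    star_mul', star_prod, star_divDiffCoeff]
  simp

theorem prod_divDiffCoeff_mul_sub (β γ : Idx d N) (j : Fin d) :
    (∏ i, divDiffCoeff (β.1 i) (γ.1 i)) * (γ.1 j - β.1 j) =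
      if 1 ≤ β.1 j then ∏ i, divDiffCoeff ((β.pred j).1 i) (γ.1 i) else 0 := by
  classical
  rw [← Finset.mul_prod_erase _ _ (Finset.mem_univ j), mul_right_comm, divDiffCoeff_mul_sub]
  split_ifs with h
  · rw [← Finset.mul_prod_erase Finset.univ
      (fun i => divDiffCoeff ((β.pred j).1 i) (γ.1 i)) (Finset.mem_univ j)]
    congr 1
    · simp [Idx.pred]
    · refine Finset.prod_congr rfl fun i hi => ?_
      have hij : j ≠ i := (Finset.ne_of_mem_erase hi).symm
      simp [Idx.pred, hij]
  · rw [zero_mul]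

/-- The Leibniz rule in the j-th variable: divided differences intertwine pointwise multiplication
by z_j with `gridShift`. -/
theorem gridDiff_mul_diagonal {ε : ℝ} (hε : ε ≠ 0) (j : Fin d) :
    gridDiff d N ε * Matrix.diagonal (fun γ : Idx d N => gridPoint ε γ j) =
      gridShift d N ε j * gridDiff d N ε := by
  ext β γ
  have hε' : (ε : ℂ) ≠ 0 := by exact_mod_cast hε
  have h := prod_divDiffCoeff_mul_sub β γ j
  rw [Matrix.mul_diagonal, gridShift, Matrix.add_mul, Matrix.add_apply, shiftMat_mul_apply,
    Matrix.smul_mul, Matrix.smul_apply, Matrix.diagonal_mul, smul_eq_mul]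
  simp only [gridDiff, Matrix.of_apply, gridPoint]
  by_cases hj : 1 ≤ β.1 j
  · rw [if_pos hj] at h ⊢
    rw [← h, ← β.degree_pred j hj]
    field_simp
    ring
  · rw [if_neg hj] at h ⊢
    linear_combination (ε * ((ε : ℂ) ^ β.1.degree)⁻¹) * h

theorem sum_gridDiff (ε : ℝ) (β : Idx d N) :
    ∑ γ, gridDiff d N ε β γ = if β.1 = 0 then 1 else 0 := by
  classical
  have h1 : ∑ γ : Idx d N, ∏ j, divDiffCoeff (β.1 j) (γ.1 j) =
      ∏ j, ∑ g ∈ Finset.range (N + 1), divDiffCoeff (β.1 j) g := by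
    rw [Finset.prod_univ_sum]
    -- The product expands over a box larger than [N]. The extra terms vanish: g ≤ β would put g in
    -- [N], so some g_j exceeds β_j.
    refine Finset.sum_of_injOn (fun γ : Idx d N => (γ.1 : Fin d → ℕ)) ?_ ?_ ?_ ?_
    · intro γ _ γ' _ h
      exact Subtype.ext (DFunLike.coe_injective h)
    · intro γ _
      simpa [Nat.lt_succ_iff] using fun j => γ.apply_le j
    · intro g _ hg
      obtain ⟨j, hj⟩ : ∃ j, β.1 j < g j := by
        by_contra! hle
        refine hg ⟨⟨Finsupp.equivFunOnFinite.symm g, ?_⟩, by simp, by simp⟩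
        exact (Finsupp.degree_mono (show Finsupp.equivFunOnFinite.symm g ≤ β.1 from hle)).trans β.2
      refine Finset.prod_eq_zero (Finset.mem_univ j) ?_
      rw [divDiffCoeff, if_neg (by omega)]
    · intro γ _
      rfl
  simp only [gridDiff, Matrix.of_apply, ← Finset.mul_sum, h1, sum_divDiffCoeff (β.apply_le _)]
  by_cases h0 : β.1 = 0
  · simp [h0]
  · obtain ⟨j, hj⟩ : ∃ j, β.1 j ≠ 0 := by
      by_contra! h
      exact h0 (Finsupp.ext h)
    rw [Finset.prod_eq_zero (Finset.mem_univ j) (if_neg hj), mul_zero, if_neg h0]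

theorem tendsto_mulVec {ι κ X : Type*} [Fintype κ] {l : Filter X}
    {A : X → Matrix ι κ ℂ} {A₀ : Matrix ι κ ℂ} {v : X → κ → ℂ} {v₀ : κ → ℂ}
    (hA : Tendsto A l (𝓝 A₀)) (hv : Tendsto v l (𝓝 v₀)) :
    Tendsto (fun x => A x *ᵥ v x) l (𝓝 (A₀ *ᵥ v₀)) :=
  tendsto_pi_nhds.2 fun i => tendsto_finsetSum _ fun k _ =>
    (tendsto_pi_nhds.1 (tendsto_pi_nhds.1 hA i) k).mul (tendsto_pi_nhds.1 hv k)

/-- True for constants, and preserved by multiplication by z_j because `gridShift` tends to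
`shiftMat`. -/
theorem tendsto_gridDiff_eval {ε : ℕ → ℝ} (hε0 : ∀ k, ε k ≠ 0) (hε : Tendsto ε atTop (𝓝 0))
    (q : MvPolynomial (Fin d) ℂ) :
    Tendsto (fun k => gridDiff d N (ε k) *ᵥ
      fun γ : Idx d N => MvPolynomial.eval (gridPoint (ε k) γ) q) atTop
      (𝓝 fun γ : Idx d N => q.coeff γ.1) := by
  classical
  induction q using MvPolynomial.induction_on with
  | C a =>
    refine tendsto_const_nhds.congr fun k => ?_
    ext β
    simp only [MvPolynomial.eval_C, Matrix.mulVec, dotProduct, ← Finset.sum_mul, sum_gridDiff]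
    rw [MvPolynomial.coeff_C]
    simp [eq_comm]
  | add q r hq hr =>
    simp only [MvPolynomial.coeff_add]
    refine (hq.add hr).congr fun k => ?_
    rw [← Matrix.mulVec_add]
    simp only [map_add]
    rfl
  | mul_X q j hq =>
    have h1 : (fun γ : Idx d N => (q * MvPolynomial.X j).coeff γ.1) =
        shiftMat d N j *ᵥ fun γ : Idx d N => q.coeff γ.1 := by
      ext α
      rw [mul_comm, coeff_X_mul_eq_shiftMat_mulVec]
    rw [h1]
    refine (tendsto_mulVec (tendsto_gridShift hε j) hq).congr fun k => ?_
    rw [Matrix.mulVec_mulVec, ← gridDiff_mul_diagonal (hε0 k), ← Matrix.mulVec_mulVec]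
    congr 1
    ext γ
    rw [Matrix.mulVec_diagonal, map_mul, MvPolynomial.eval_X, mul_comm]

theorem norm_gridPoint_le (ε : ℝ) (γ : Idx d N) : ‖gridPoint ε γ‖ ≤ |ε| * N := by
  rw [pi_norm_le_iff_of_nonneg (by positivity)]
  intro j
  rw [gridPoint, norm_mul, Complex.norm_real, Real.norm_eq_abs, Complex.norm_natCast]
  have : (γ.1 j : ℝ) ≤ N := by exact_mod_cast γ.apply_le j
  gcongr

/-- The samples are O(ε^(N+1)), while the divided difference divides only by ε^|β| with |β| ≤ N. -/
theorem tendsto_gridDiff_of_isBigO {ε : ℕ → ℝ} (hε0 : ∀ k, ε k ≠ 0) (hε : Tendsto ε atTop (𝓝 0))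
    {f : (Fin d → ℂ) → ℂ} (hf : f =O[𝓝 0] fun z => ‖z‖ ^ (N + 1)) :
    Tendsto (fun k => gridDiff d N (ε k) *ᵥ fun γ : Idx d N => f (gridPoint (ε k) γ)) atTop
      (𝓝 0) := by
  refine tendsto_pi_nhds.2 fun β => ?_
  simp only [Matrix.mulVec, dotProduct, Pi.zero_apply]
  rw [← Finset.sum_const_zero (s := (Finset.univ : Finset (Idx d N)))]
  refine tendsto_finsetSum _ fun γ _ => ?_
  have hpt : Tendsto (fun k => gridPoint (ε k) γ) atTop (𝓝 0) := by
    refine squeeze_zero_norm (fun k => norm_gridPoint_le (ε k) γ) ?_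
    simpa using hε.abs.mul_const (N : ℝ)
  obtain ⟨c, hc0, hc⟩ := (hf.comp_tendsto hpt).exists_nonneg
  have hlim : Tendsto (fun k => (‖∏ j, divDiffCoeff (β.1 j) (γ.1 j)‖ * (c * N ^ (N + 1))) *
      |ε k| ^ (N + 1 - β.1.degree)) atTop (𝓝 0) := by
    have h1 := (hε.abs.pow (N + 1 - β.1.degree)).const_mul
      (‖∏ j, divDiffCoeff (β.1 j) (γ.1 j)‖ * (c * N ^ (N + 1)))
    have h2 := β.2
    rwa [abs_zero, zero_pow (by omega), mul_zero] at h1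
  refine squeeze_zero_norm' ?_ hlim
  filter_upwards [hc.bound] with k hk
  simp only [Function.comp_apply, norm_pow, norm_norm] at hk
  have hε' : 0 < |ε k| := abs_pos.2 (hε0 k)
  have hβ : N + 1 - β.1.degree + β.1.degree = N + 1 := by
    have := β.2
    omega
  have hk' : ‖f (gridPoint (ε k) γ)‖ ≤ c * (|ε k| * N) ^ (N + 1) := by
    refine hk.trans ?_
    have := norm_gridPoint_le (ε k) γ
    gcongr
  rw [norm_mul, gridDiff, Matrix.of_apply, norm_mul, norm_inv, norm_pow, Complex.norm_real,
    Real.norm_eq_abs]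
  calc _ ≤ (|ε k| ^ β.1.degree)⁻¹ * ‖∏ j, divDiffCoeff (β.1 j) (γ.1 j)‖ *
        (c * (|ε k| * N) ^ (N + 1)) := by gcongr
    _ = _ := by
      rw [mul_pow, ← hβ, pow_add, hβ]
      field_simp

theorem hasMatrixDecomposition_of_aglerDecomposition {p : MvPolynomial (Fin d) ℂ}
    {φ : (Fin d → ℂ) → ℂ}
    (hφ : VanishesToOrder (N + 1) fun z => MvPolynomial.eval z p - φ z)
    (h : HasAglerDecomposition φ) : HasMatrixDecomposition N p := by
  classical
  obtain ⟨K, hK, hKφ⟩ := h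
  -- The factor 1/(N+1) keeps the grid in the polydisk, since its coordinates are at most εN.
  let ε : ℕ → ℝ := fun k => 1 / ((k : ℝ) + 1) * ((N : ℝ) + 1)⁻¹
  have hεpos : ∀ k, 0 < ε k := fun k => by positivity
  have hε0 : ∀ k, ε k ≠ 0 := fun k => (hεpos k).ne'
  have hε : Tendsto ε atTop (𝓝 0) := by
    have h1 := (tendsto_one_div_add_atTop_nhds_zero_nat (𝕜 := ℝ)).mul_const ((N : ℝ) + 1)⁻¹
    rwa [zero_mul] at h1
  have hx : ∀ k (γ : Idx d N), gridPoint (ε k) γ ∈ polydisk d := by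
    intro k γ j
    refine ((norm_le_pi_norm (gridPoint (ε k) γ) j).trans (norm_gridPoint_le _ γ)).trans_lt ?_
    rw [abs_of_pos (hεpos k)]
    have h1 : 1 / ((k : ℝ) + 1) ≤ 1 := by
      rw [div_le_one (by positivity)]
      have : (0 : ℝ) ≤ k := by positivity
      linarith
    have h2 : ((N : ℝ) + 1)⁻¹ * N < 1 := by
      rw [inv_mul_lt_iff₀ (by positivity)]
      linarith
    have h3 : (0 : ℝ) ≤ ((N : ℝ) + 1)⁻¹ * N := by positivity
    calc ε k * N = 1 / ((k : ℝ) + 1) * (((N : ℝ) + 1)⁻¹ * N) := by simp only [ε]; ring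
      _ ≤ 1 * (((N : ℝ) + 1)⁻¹ * N) := by gcongr
      _ < 1 := by linarith
  let Δ : ℕ → Matrix (Idx d N) (Idx d N) ℂ := fun k => gridDiff d N (ε k)
  let Φ : ℕ → Idx d N → ℂ := fun k γ => φ (gridPoint (ε k) γ)
  -- The arguments are swapped because rows carry the conjugated variable w; positivity survives
  -- transposition.
  let Kt : ℕ → Fin d → Matrix (Idx d N) (Idx d N) ℂ := fun k j =>
    Matrix.of fun γ δ => K j (gridPoint (ε k) δ) (gridPoint (ε k) γ)
  have hKt : ∀ k j, (Kt k j).PosSemidef := by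
    intro k j
    have h1 := hK j _ (fun i => gridPoint (ε k) ((Fintype.equivFin (Idx d N)).symm i))
      fun i => hx k _
    have h2 := (h1.submatrix (Fintype.equivFin (Idx d N))).transpose
    refine (congrArg Matrix.PosSemidef ?_).mpr h2
    ext γ δ
    simp [Kt]
  have hid : ∀ k, Matrix.vecMulVec 1 1 - Matrix.vecMulVec (star (Φ k)) (Φ k) =
      ∑ j, (Kt k j - Matrix.diagonal (fun γ : Idx d N => gridPoint (ε k) γ j) * Kt k j *
        Matrix.diagonal (fun γ : Idx d N => gridPoint (ε k) γ j)) := by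
    intro k
    ext γ δ
    have h1 := hKφ _ (hx k δ) _ (hx k γ)
    rw [Matrix.sum_apply, Matrix.sub_apply, Matrix.vecMulVec_apply, Matrix.vecMulVec_apply]
    simp only [Pi.one_apply, mul_one, Pi.star_apply, Φ]
    refine h1.trans (Finset.sum_congr rfl fun j _ => ?_)
    rw [Matrix.sub_apply, Matrix.mul_diagonal, Matrix.diagonal_mul]
    simp only [Kt, Matrix.of_apply, gridPoint, map_mul, Complex.conj_ofReal, map_natCast]
    ring
  have hDS : ∀ k j, (gridShift d N (ε k) j)ᴴ = (gridShift d N (ε k) j)ᵀ := by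
    intro k j
    ext α β
    simp only [gridShift, Matrix.conjTranspose_apply, Matrix.transpose_apply, Matrix.add_apply,
      Matrix.smul_apply, shiftMat_apply, star_add, smul_eq_mul, star_mul', Matrix.diagonal_apply]
    congr 1
    · split_ifs <;> simp
    · split_ifs <;> simp
  have hΔstar : ∀ k v, star (Δ k *ᵥ v) = Δ k *ᵥ star v := by
    intro k v
    rw [Matrix.star_mulVec, gridDiff_conjTranspose, Matrix.vecMul_transpose]
  -- Multiply `hid` by Δ on the left and Δᵀ = Δᴴ on the right, then move the diagonal matrices past
  -- Δ.
  have hmain : ∀ k, Matrix.vecMulVec (Δ k *ᵥ 1) (Δ k *ᵥ 1) -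
      Matrix.vecMulVec (star (Δ k *ᵥ Φ k)) (Δ k *ᵥ Φ k) =
      ∑ j, (Δ k * Kt k j * (Δ k)ᴴ -
        gridShift d N (ε k) j * (Δ k * Kt k j * (Δ k)ᴴ) * (gridShift d N (ε k) j)ᴴ) := by
    intro k
    have h1 := congrArg (fun M => Δ k * M * (Δ k)ᵀ) (hid k)
    simp only [Matrix.mul_sub, Matrix.sub_mul, Matrix.mul_sum, Matrix.sum_mul,
      Matrix.mul_vecMulVec, Matrix.vecMulVec_mul, Matrix.vecMul_transpose] at h1
    rw [hΔstar]
    refine h1.trans (Finset.sum_congr rfl fun j _ => ?_)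
    have h2 : Δ k * Matrix.diagonal (fun γ : Idx d N => gridPoint (ε k) γ j) =
      gridShift d N (ε k) j * Δ k := gridDiff_mul_diagonal (hε0 k) j
    have h3 := congrArg Matrix.transpose h2
    rw [Matrix.transpose_mul, Matrix.transpose_mul, Matrix.diagonal_transpose] at h3
    rw [hDS, show (Δ k)ᴴ = (Δ k)ᵀ from gridDiff_conjTranspose _]
    congr 1
    calc _ = (Δ k * Matrix.diagonal (fun γ : Idx d N => gridPoint (ε k) γ j)) * Kt k j *
          (Matrix.diagonal (fun γ : Idx d N => gridPoint (ε k) γ j) * (Δ k)ᵀ) := by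
            simp only [Matrix.mul_assoc]
      _ = _ := by rw [h2, h3]; simp only [Matrix.mul_assoc]
  have hone : Tendsto (fun k => Δ k *ᵥ (1 : Idx d N → ℂ)) atTop
      (𝓝 fun γ : Idx d N => if γ.1 = 0 then 1 else 0) := by
    refine tendsto_const_nhds.congr fun k => ?_
    ext β
    simp only [Matrix.mulVec, dotProduct, Pi.one_apply, mul_one, Δ, sum_gridDiff]
  have hphi : Tendsto (fun k => Δ k *ᵥ Φ k) atTop (𝓝 fun γ : Idx d N => p.coeff γ.1) := by
    have h1 := (tendsto_gridDiff_eval hε0 hε p).sub (tendsto_gridDiff_of_isBigO hε0 hε hφ.isBigO)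
    rw [sub_zero] at h1
    refine h1.congr fun k => ?_
    rw [← Matrix.mulVec_sub]
    congr 1
    ext γ
    simp [Φ]
  refine exists_decomposition_of_tendsto
    (fun k j => (hKt k j).mul_mul_conjTranspose_same (Δ k)) hε (M := fun k => _) ?_
    fun k => hmain k
  refine tendsto_pi_nhds.2 fun α => tendsto_pi_nhds.2 fun β => ?_
  have h1 := ((tendsto_pi_nhds.1 hone α).mul (tendsto_pi_nhds.1 hone β)).sub
    ((tendsto_pi_nhds.1 hphi α).star.mul (tendsto_pi_nhds.1 hphi β))
  have h2 : defect N p α β = (if α.1 = 0 then 1 else 0) * (if β.1 = 0 then 1 else 0) -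
      star (p.coeff α.1) * p.coeff β.1 := by
    rw [defect, Matrix.of_apply]
    congr 1
    by_cases h2 : α.1 = 0 <;> by_cases h3 : β.1 = 0 <;> simp [h2, h3]
  rw [h2]
  exact h1

end Grid

/-! ### Transfer functions of unitary block matrices. -/

section TransferFunction

variable {d : ℕ} {κ : Type*} [Fintype κ] [DecidableEq κ]

theorem star_mulVec_dotProduct_mulVec {ι : Type*} [Fintype ι] [DecidableEq ι] {U : Matrix ι ι ℂ}
    (hU : Uᴴ * U = 1) (v w : ι → ℂ) : star (U *ᵥ v) ⬝ᵥ (U *ᵥ w) = star v ⬝ᵥ w := by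
  rw [Matrix.star_mulVec, ← Matrix.dotProduct_mulVec, Matrix.mulVec_mulVec, hU, Matrix.one_mulVec]

theorem norm_det_eq_one {ι : Type*} [Fintype ι] [DecidableEq ι] {U : Matrix ι ι ℂ}
    (hU : Uᴴ * U = 1) : ‖U.det‖ = 1 := by
  have h := congrArg (fun M => ‖Matrix.det M‖) hU
  simp only [Matrix.det_mul, Matrix.det_conjTranspose, norm_mul, norm_star, Matrix.det_one,
    norm_one] at h
  nlinarith [norm_nonneg U.det]

/-- The diagonal matrix with entries `z_{τ i}`. -/
def diagOf (τ : κ → Fin d) (z : Fin d → ℂ) : Matrix κ κ ℂ :=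
  Matrix.diagonal fun i => z (τ i)

/-- The matrix `b E_z` with polynomial entries. -/
noncomputable def mulPolyDiag {ι κ : Type*} (τ : κ → Fin d) (b : Matrix ι κ ℂ) :
    Matrix ι κ (MvPolynomial (Fin d) ℂ) :=
  Matrix.of fun i k => MvPolynomial.C (b i k) * MvPolynomial.X (τ k)

/-- The denominator `det (1 - D E_z)` of the transfer function. -/
noncomputable def transferDen (τ : κ → Fin d) (D : Matrix κ κ ℂ) : MvPolynomial (Fin d) ℂ :=
  (1 - mulPolyDiag τ D).det

/-- The numerator of the transfer function. -/
noncomputable def transferNum (τ : κ → Fin d) (A : Matrix Unit Unit ℂ) (b : Matrix Unit κ ℂ)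
    (c : Matrix κ Unit ℂ) (D : Matrix κ κ ℂ) : MvPolynomial (Fin d) ℂ :=
  (Matrix.fromBlocks (A.map MvPolynomial.C) (-mulPolyDiag τ b)
    (c.map MvPolynomial.C) (1 - mulPolyDiag τ D)).det

theorem map_eval_mulPolyDiag {ι : Type*} (τ : κ → Fin d) (b : Matrix ι κ ℂ) (z : Fin d → ℂ) :
    (mulPolyDiag τ b).map (MvPolynomial.eval z) =
      b * diagOf τ z := by
  ext i k
  simp [mulPolyDiag, diagOf, Matrix.mul_diagonal]

theorem map_eval_one_sub_mulPolyDiag (τ : κ → Fin d) (D : Matrix κ κ ℂ) (z : Fin d → ℂ) :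
    (1 - mulPolyDiag τ D).map (MvPolynomial.eval z) =
      1 - D * diagOf τ z := by
  rw [Matrix.map_sub _ (map_sub _), map_eval_mulPolyDiag, Matrix.map_one _ (map_zero _) (map_one _)]

theorem eval_transferDen (τ : κ → Fin d) (D : Matrix κ κ ℂ) (z : Fin d → ℂ) :
    MvPolynomial.eval z (transferDen τ D) = (1 - D * diagOf τ z).det := by
  rw [transferDen, RingHom.map_det, RingHom.mapMatrix_apply, map_eval_one_sub_mulPolyDiag]

variable (τ : κ → Fin d) {A : Matrix Unit Unit ℂ} {b : Matrix Unit κ ℂ}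
    {c : Matrix κ Unit ℂ} {D : Matrix κ κ ℂ}

theorem eval_transferNum (z : Fin d → ℂ) :
    MvPolynomial.eval z (transferNum τ A b c D) =
      (Matrix.fromBlocks A (-(b * diagOf τ z)) c (1 - D * diagOf τ z)).det := by
  rw [transferNum, RingHom.map_det, RingHom.mapMatrix_apply, Matrix.fromBlocks_map,
    map_eval_one_sub_mulPolyDiag, Matrix.map_neg _ (map_neg _), map_eval_mulPolyDiag]
  congr 2 <;> (ext; simp)

/-- If x = D E_z x with x ≠ 0, put y = E_z x. Isometry of U on (0, y) gives ‖x‖ ≤ ‖y‖, whereas ‖y‖ <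
‖x‖ inside the polydisk. -/
theorem eval_transferDen_ne_zero
    (hU : (Matrix.fromBlocks A b c D)ᴴ * Matrix.fromBlocks A b c D = 1) {z : Fin d → ℂ}
    (hz : z ∈ polydisk d) : MvPolynomial.eval z (transferDen τ D) ≠ 0 := by
  rw [eval_transferDen]
  intro h0
  obtain ⟨x, hx, hx0⟩ := Matrix.exists_mulVec_eq_zero_iff.2 h0
  rw [Matrix.sub_mulVec, Matrix.one_mulVec, sub_eq_zero, ← Matrix.mulVec_mulVec] at hx0
  set y := diagOf τ z *ᵥ x with hy
  have h1 := congrArg Complex.re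
    (star_mulVec_dotProduct_mulVec hU (Sum.elim 0 y) (Sum.elim 0 y))
  rw [re_star_dotProduct_self, re_star_dotProduct_self, Matrix.fromBlocks_mulVec,
    Fintype.sum_sum_type, Fintype.sum_sum_type] at h1
  simp only [Sum.elim_inl, Sum.elim_inr, Sum.elim_comp_inl, Sum.elim_comp_inr, Matrix.mulVec_zero,
    zero_add, ← hx0, Pi.zero_apply, norm_zero] at h1
  have h2 : ∑ i, ‖x i‖ ^ 2 ≤ ∑ i, ‖y i‖ ^ 2 := by
    have : 0 ≤ ∑ i : Unit, ‖(b *ᵥ y) i‖ ^ 2 := by positivity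
    have h3 : ∑ i : Unit, (0 : ℝ) ^ 2 = 0 := by simp
    linarith
  have hyx : ∀ i, ‖y i‖ ^ 2 = ‖z (τ i)‖ ^ 2 * ‖x i‖ ^ 2 := by
    intro i
    rw [hy, diagOf, Matrix.mulVec_diagonal, norm_mul, mul_pow]
  obtain ⟨i, hi⟩ := Function.ne_iff.1 hx
  have hzi : ∀ i, ‖z (τ i)‖ ^ 2 < 1 := fun i =>
    pow_lt_one₀ (norm_nonneg _) (hz (τ i)) two_ne_zero
  have h3 : ∑ i, ‖y i‖ ^ 2 < ∑ i, ‖x i‖ ^ 2 := by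
    refine Finset.sum_lt_sum (fun k _ => ?_) ⟨i, Finset.mem_univ _, ?_⟩
    · rw [hyx]
      exact mul_le_of_le_one_left (by positivity) (hzi k).le
    · rw [hyx]
      have : 0 < ‖x i‖ := norm_pos_iff.2 hi
      exact mul_lt_of_lt_one_left (by positivity) (hzi i)
  linarith

/-- On the torus E is unitary. Multiplying the numerator's matrix by Uᴴ makes it block triangular
with corner Dᴴ - E = -(1 - E D)ᴴ E, and det(1 - E D) = det(1 - D E). -/
theorem norm_eval_transferDen_eq
    (hU : (Matrix.fromBlocks A b c D)ᴴ * Matrix.fromBlocks A b c D = 1) {z : Fin d → ℂ}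
    (hz : z ∈ torus d) : ‖MvPolynomial.eval z (transferDen τ D)‖ =
      ‖MvPolynomial.eval z (transferNum τ A b c D)‖ := by
  rw [eval_transferDen, eval_transferNum]
  set E := diagOf τ z with hE
  have hEE : Eᴴ * E = 1 := by
    rw [hE, diagOf, Matrix.diagonal_conjTranspose, Matrix.diagonal_mul_diagonal,
      ← Matrix.diagonal_one]
    congr 1
    ext i
    rw [Pi.star_apply, RCLike.star_def, RCLike.conj_mul, hz (τ i)]
    simp
  have h1 : Matrix.fromBlocks A (-(b * E)) c (1 - D * E) =
      Matrix.fromBlocks A b c D * Matrix.fromBlocks 1 0 0 (-E) +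
        Matrix.fromBlocks 0 0 0 (1 : Matrix κ κ ℂ) := by
    rw [Matrix.fromBlocks_multiply, Matrix.fromBlocks_add]
    congr 1 <;> simp [sub_eq_neg_add]
  have h2 : (Matrix.fromBlocks A b c D)ᴴ * Matrix.fromBlocks A (-(b * E)) c (1 - D * E) =
      Matrix.fromBlocks 1 cᴴ 0 (Dᴴ - E) := by
    rw [h1, Matrix.mul_add, ← Matrix.mul_assoc, hU, Matrix.one_mul,
      Matrix.fromBlocks_conjTranspose, Matrix.fromBlocks_multiply, Matrix.fromBlocks_add]
    congr 1 <;> simp [sub_eq_neg_add]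
  have h3 : Dᴴ - E = -((1 - E * D)ᴴ * E) := by
    rw [Matrix.conjTranspose_sub, Matrix.conjTranspose_mul, Matrix.sub_mul, Matrix.mul_assoc, hEE,
      Matrix.conjTranspose_one, Matrix.one_mul, Matrix.mul_one, neg_sub]
  have h4 := congrArg (fun M => ‖Matrix.det M‖) h2
  simp only [Matrix.det_mul, norm_mul, Matrix.det_conjTranspose, norm_star, norm_det_eq_one hU,
    one_mul, Matrix.det_fromBlocks_zero₂₁, Matrix.det_one, h3, Matrix.det_neg,
    norm_det_eq_one hEE, mul_one, norm_pow, norm_neg, norm_one, one_pow] at h4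
  rw [h4, Matrix.det_one_sub_mul_comm]

/-- The state `(1 - D E_z)⁻¹ c`. -/
noncomputable def stateVec (c : Matrix κ Unit ℂ) (D : Matrix κ κ ℂ) (z : Fin d → ℂ) : κ → ℂ :=
  (1 - D * diagOf τ z)⁻¹ *ᵥ c.col ()

/-- The transfer function of a block matrix. -/
noncomputable def transfer (A : Matrix Unit Unit ℂ) (b : Matrix Unit κ ℂ)
    (c : Matrix κ Unit ℂ) (D : Matrix κ κ ℂ) (z : Fin d → ℂ) : ℂ :=
  MvPolynomial.eval z (transferNum τ A b c D) / MvPolynomial.eval z (transferDen τ D)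

/-- By the Schur complement, the quotient of determinants is A + b E (1 - D E)⁻¹ c. -/
theorem fromBlocks_mulVec_stateVec {z : Fin d → ℂ}
    (hz : MvPolynomial.eval z (transferDen τ D) ≠ 0) :
    Matrix.fromBlocks A b c D *ᵥ Sum.elim (1 : Unit → ℂ) (diagOf τ z *ᵥ stateVec τ c D z) =
      Sum.elim (fun _ => transfer τ A b c D z) (stateVec τ c D z) := by
  have hz' := hz
  rw [eval_transferDen] at hz'
  have hu : IsUnit (1 - D * diagOf τ z).det := isUnit_iff_ne_zero.2 hz'
  let _ := (1 - D * diagOf τ z).invertibleOfIsUnitDet hu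
  rw [Matrix.fromBlocks_mulVec]
  congr 1
  · ext i
    rw [transfer, eval_transferNum, eval_transferDen, Matrix.det_fromBlocks₂₂,
      mul_div_cancel_left₀ _ hz', Matrix.det_unique, Matrix.invOf_eq_nonsing_inv]
    simp only [Sum.elim_comp_inl, Sum.elim_comp_inr, stateVec, Matrix.mulVec_mulVec, Pi.add_apply]
    rw [Matrix.sub_apply, Matrix.neg_mul, Matrix.neg_mul, Matrix.neg_apply, sub_neg_eq_add]
    congr 1
    · simp [Matrix.mulVec, dotProduct]
    · simp only [← Matrix.mul_assoc]
      rfl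
  · simp only [Sum.elim_comp_inl, Sum.elim_comp_inr]
    have h1 : (1 - D * diagOf τ z) *ᵥ stateVec τ c D z = c.col () := by
      rw [stateVec, Matrix.mulVec_mulVec, Matrix.mul_nonsing_inv _ hu, Matrix.one_mulVec]
    rw [Matrix.sub_mulVec, Matrix.one_mulVec, sub_eq_iff_eq_add, ← Matrix.mulVec_mulVec] at h1
    have h2 : c *ᵥ (1 : Unit → ℂ) = c.col () := by
      ext i
      simp [Matrix.mulVec, dotProduct]
    rw [h2, ← h1]

/-- U preserves the inner product of the vectors (1, E h) at w and at z, where h is the state, and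
sends them to (φ, h). -/
theorem transfer_agler_identity
    (hU : (Matrix.fromBlocks A b c D)ᴴ * Matrix.fromBlocks A b c D = 1) {z w : Fin d → ℂ}
    (hz : z ∈ polydisk d) (hw : w ∈ polydisk d) :
    1 - starRingEnd ℂ (transfer τ A b c D w) * transfer τ A b c D z =
      ∑ i, (1 - starRingEnd ℂ (w (τ i)) * z (τ i)) *
        (starRingEnd ℂ (stateVec τ c D w i) * stateVec τ c D z i) := by
  have h := star_mulVec_dotProduct_mulVec hU (Sum.elim (1 : Unit → ℂ) (diagOf τ w *ᵥ stateVec τ c D w))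
    (Sum.elim (1 : Unit → ℂ) (diagOf τ z *ᵥ stateVec τ c D z))
  rw [fromBlocks_mulVec_stateVec τ (eval_transferDen_ne_zero τ hU hz),
    fromBlocks_mulVec_stateVec τ (eval_transferDen_ne_zero τ hU hw)] at h
  simp only [dotProduct, Fintype.sum_sum_type, Pi.star_apply, Sum.elim_inl, Sum.elim_inr,
    Finset.univ_unique, Finset.sum_singleton, Pi.one_apply, mul_one, diagOf,
    Matrix.mulVec_diagonal, RCLike.star_def, map_mul, map_one] at h
  simp only [sub_mul, one_mul, Finset.sum_sub_distrib]
  have h2 : ∑ i, starRingEnd ℂ (w (τ i)) * z (τ i) *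
      (starRingEnd ℂ (stateVec τ c D w i) * stateVec τ c D z i) =
      ∑ i, starRingEnd ℂ (w (τ i)) * starRingEnd ℂ (stateVec τ c D w i) *
        (z (τ i) * stateVec τ c D z i) := Finset.sum_congr rfl fun i _ => by ring
  rw [h2]
  linear_combination -h

theorem norm_transfer_le_one
    (hU : (Matrix.fromBlocks A b c D)ᴴ * Matrix.fromBlocks A b c D = 1) {z : Fin d → ℂ}
    (hz : z ∈ polydisk d) : ‖transfer τ A b c D z‖ ≤ 1 := by
  have h2 : 1 - ‖transfer τ A b c D z‖ ^ 2 =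
      ∑ i, (1 - ‖z (τ i)‖ ^ 2) * ‖stateVec τ c D z i‖ ^ 2 := by
    have h3 := transfer_agler_identity τ hU hz hz
    simp only [RCLike.conj_mul, Complex.coe_algebraMap] at h3
    exact_mod_cast h3
  have h4 : 0 ≤ ∑ i, (1 - ‖z (τ i)‖ ^ 2) * ‖stateVec τ c D z i‖ ^ 2 := by
    refine Finset.sum_nonneg fun i _ => mul_nonneg ?_ (by positivity)
    have := pow_le_one₀ (n := 2) (norm_nonneg _) (hz (τ i)).le
    linarith
  nlinarith [norm_nonneg (transfer τ A b c D z)]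

theorem isRationalInner_transfer
    (hU : (Matrix.fromBlocks A b c D)ᴴ * Matrix.fromBlocks A b c D = 1) :
    IsRationalInner (transfer τ A b c D) :=
  ⟨fun _ hz => norm_transfer_le_one τ hU hz, transferNum τ A b c D, transferDen τ D,
    fun _ hz => eval_transferDen_ne_zero τ hU hz, fun _ hz => norm_eval_transferDen_eq τ hU hz,
    fun _ _ => rfl⟩

theorem hasAglerDecomposition_transfer
    (hU : (Matrix.fromBlocks A b c D)ᴴ * Matrix.fromBlocks A b c D = 1) :
    HasAglerDecomposition (transfer τ A b c D) := by
  refine ⟨fun j z w => ∑ i, if τ i = j then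
    starRingEnd ℂ (stateVec τ c D w i) * stateVec τ c D z i else 0, fun j m x _ => ?_,
    fun z hz w hw => ?_⟩
  · let B : Matrix (Fin m) κ ℂ := Matrix.of fun k i => if τ i = j then stateVec τ c D (x k) i else 0
    refine (congrArg Matrix.PosSemidef ?_).mpr (Matrix.posSemidef_self_mul_conjTranspose B)
    ext k l
    rw [Matrix.of_apply, Matrix.mul_apply]
    refine Finset.sum_congr rfl fun i _ => ?_
    by_cases h : τ i = j <;> simp [B, h, mul_comm]
  · rw [transfer_agler_identity τ hU hz hw]
    simp only [Finset.mul_sum]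
    rw [Finset.sum_comm]
    refine Finset.sum_congr rfl fun i _ => ?_
    rw [Finset.sum_eq_single (τ i)]
    · simp
    · intro j _ hj
      rw [if_neg hj.symm, mul_zero]
    · simp

theorem eval_transferDen_zero : MvPolynomial.eval (0 : Fin d → ℂ) (transferDen τ D) = 1 := by
  have : diagOf τ (0 : Fin d → ℂ) = 0 := by
    ext i k
    simp [diagOf]
  rw [eval_transferDen, this]
  simp

theorem analyticAt_transfer : AnalyticAt ℂ (transfer τ A b c D) 0 := by
  refine (AnalyticOnNhd.eval_mvPolynomial (transferNum τ A b c D) 0 (Set.mem_univ _)).fun_div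
    (AnalyticOnNhd.eval_mvPolynomial (transferDen τ D) 0 (Set.mem_univ _)) ?_
  rw [eval_transferDen_zero]
  exact one_ne_zero

theorem isBigO_inv_one_sub_apply (i k : κ) :
    (fun z : Fin d → ℂ => (1 - D * diagOf τ z)⁻¹ i k) =O[𝓝 0] fun _ => (1 : ℝ) := by
  have hc : Continuous fun z : Fin d → ℂ => 1 - D * diagOf τ z := by
    unfold diagOf
    fun_prop
  have h1 : ContinuousAt (fun z : Fin d → ℂ => (1 - D * diagOf τ z).det⁻¹) 0 := by
    refine hc.matrix_det.continuousAt.inv₀ ?_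
    rw [← eval_transferDen, eval_transferDen_zero]
    exact one_ne_zero
  have h2 : Continuous fun z : Fin d → ℂ => (1 - D * diagOf τ z).adjugate i k :=
    hc.matrix_adjugate.matrix_elem i k
  have h3 : ContinuousAt (fun z : Fin d → ℂ => (1 - D * diagOf τ z)⁻¹ i k) 0 := by
    refine (h1.mul h2.continuousAt).congr (Eventually.of_forall fun z => ?_)
    simp only [Matrix.inv_def, Ring.inverse_eq_inv', Matrix.smul_apply, smul_eq_mul, Pi.mul_apply]
  exact h3.tendsto.isBigO_one ℝ

end TransferFunction

/-! ### The inner function built from a matrix decomposition. -/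

section Realization

variable {d N : ℕ}

/-- `z^α`. -/
def monomialEval (z : Fin d → ℂ) (α : Fin d →₀ ℕ) : ℂ := ∏ j, z j ^ α j

theorem monomialEval_add_single (z : Fin d → ℂ) (α : Fin d →₀ ℕ) (j : Fin d) :
    monomialEval z (α + Finsupp.single j 1) = z j * monomialEval z α := by
  classical
  simp only [monomialEval, Finsupp.add_apply, pow_add, Finset.prod_mul_distrib]
  rw [mul_comm]
  congr 1
  rw [Finset.prod_eq_single j]
  · simp
  · intro i _ hi
    simp [hi.symm]
  · simp

theorem norm_monomialEval_le (z : Fin d → ℂ) (α : Fin d →₀ ℕ) :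
    ‖monomialEval z α‖ ≤ ‖z‖ ^ α.degree := by
  rw [monomialEval, norm_prod, Finsupp.degree_eq_sum, ← Finset.prod_pow_eq_pow_sum]
  refine Finset.prod_le_prod (fun _ _ => norm_nonneg _) fun j _ => ?_
  rw [norm_pow]
  exact pow_le_pow_left₀ (norm_nonneg _) (norm_le_pi_norm z j) _

theorem eval_eq_sum_monomialEval {p : MvPolynomial (Fin d) ℂ} (hp : p.totalDegree ≤ N)
    (z : Fin d → ℂ) :
    MvPolynomial.eval z p = ∑ α : Idx d N, p.coeff α.1 * monomialEval z α.1 := by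
  rw [MvPolynomial.eval_eq']
  exact sum_support_smul hp (monomialEval z)

/-- The homogeneous part of degree `N` of the polynomial with coefficients `a`. -/
noncomputable def topPart (a : Idx d N → ℂ) (z : Fin d → ℂ) : ℂ :=
  ∑ α : Idx d N, if α.1.degree = N then a α * monomialEval z α.1 else 0

theorem isBigO_topPart (a : Idx d N → ℂ) :
    (fun z => topPart a z) =O[𝓝 0] fun z => ‖z‖ ^ N := by
  unfold topPart
  refine Asymptotics.IsBigO.fun_sum fun α _ => ?_
  split_ifs with h
  · refine Asymptotics.IsBigO.of_bound ‖a α‖ (Eventually.of_forall fun z => ?_)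
    rw [norm_mul, norm_pow, norm_norm]
    have := norm_monomialEval_le z α.1
    rw [h] at this
    gcongr
  · exact Asymptotics.isBigO_zero _ _

theorem sum_shiftMat_mulVec_mul_monomialEval (j : Fin d) (a : Idx d N → ℂ) (z : Fin d → ℂ) :
    ∑ α : Idx d N, (shiftMat d N j *ᵥ a) α * monomialEval z α.1 =
      z j * (∑ α : Idx d N, a α * monomialEval z α.1 - topPart a z) := by
  have h := sum_shiftMat_mulVec_smul j a (fun α => if α.degree ≤ N then monomialEval z α else 0)
    fun α hα => if_neg (not_le.2 hα)
  simp only [smul_eq_mul] at h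
  refine (Finset.sum_congr rfl fun α _ => by rw [if_pos α.2]).trans (h.trans ?_)
  rw [topPart, ← Finset.sum_sub_distrib, Finset.mul_sum]
  refine Finset.sum_congr rfl fun α _ => ?_
  have h1 := α.2
  rw [map_add, Finsupp.degree_single, monomialEval_add_single]
  by_cases h2 : α.1.degree = N
  · rw [if_neg (by omega), if_pos h2]
    ring
  · rw [if_pos (by omega), if_neg h2]
    ring

/-- Let P collect the polynomials with coefficients a and H their parts of degree N. The lurking
isometry satisfies U(1, E(P - H)) = (p, P), while the state h satisfies U(1, E h) = (φ, h).
Subtracting gives p - φ = -b E (1 - D E)⁻¹ H, of order N + 1 since H has order N. -/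
theorem exists_rationalInner {p : MvPolynomial (Fin d) ℂ} (hp : p.totalDegree ≤ N)
    (h : HasMatrixDecomposition N p) :
    ∃ φ : (Fin d → ℂ) → ℂ, IsRationalInner φ ∧
      VanishesToOrder (N + 1) (fun z => MvPolynomial.eval z p - φ z) ∧
      HasAglerDecomposition φ := by
  classical
  obtain ⟨m, a, ha⟩ := (hasMatrixDecomposition_iff_gram p).1 h
  let κ := Fin d × Fin m
  let F : Matrix (Unit ⊕ κ) (Idx d N) ℂ := Matrix.of
    (Sum.elim (fun _ α => if α.1 = 0 then 1 else 0) fun i => shiftMat d N i.1 *ᵥ a i.1 i.2)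
  let G : Matrix (Unit ⊕ κ) (Idx d N) ℂ := Matrix.of
    (Sum.elim (fun _ α => p.coeff α.1) fun i => a i.1 i.2)
  -- The decomposition with its negative terms moved to the other side.
  have hFG : Fᴴ * F = Gᴴ * G := by
    ext α β
    have h1 := ha α β
    have h2 : (if α.1 = 0 ∧ β.1 = 0 then (1 : ℂ) else 0) =
        star (if α.1 = 0 then (1 : ℂ) else 0) * (if β.1 = 0 then 1 else 0) := by
      by_cases h2 : α.1 = 0 <;> by_cases h3 : β.1 = 0 <;> simp [h2, h3]
    simp only [defect, Matrix.of_apply, Finset.sum_sub_distrib, h2] at h1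
    simp only [Matrix.mul_apply, Fintype.sum_sum_type, Finset.univ_unique, Finset.sum_singleton,
      Matrix.conjTranspose_apply, F, G, Matrix.of_apply, Sum.elim_inl, Sum.elim_inr, κ,
      Fintype.sum_prod_type]
    simp only [RCLike.star_def] at h1 ⊢
    linear_combination h1
  obtain ⟨U, hU, hUF⟩ := exists_unitary_mul_eq hFG
  rw [← Matrix.fromBlocks_toBlocks U] at hU hUF
  set A := U.toBlocks₁₁
  set b := U.toBlocks₁₂
  set c := U.toBlocks₂₁
  set D := U.toBlocks₂₂
  let τ : κ → Fin d := Prod.fst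
  refine ⟨transfer τ A b c D, isRationalInner_transfer τ hU, ?_, hasAglerDecomposition_transfer τ hU⟩
  refine vanishesToOrder_of_isBigO ((AnalyticOnNhd.eval_mvPolynomial p 0 (Set.mem_univ _)).sub
    (analyticAt_transfer τ)) ?_
  let H : (Fin d → ℂ) → κ → ℂ := fun z i => topPart (a i.1 i.2) z
  let P : (Fin d → ℂ) → κ → ℂ := fun z i => ∑ α : Idx d N, a i.1 i.2 α * monomialEval z α.1
  have hP : ∀ z, Matrix.fromBlocks A b c D *ᵥ Sum.elim (1 : Unit → ℂ) (diagOf τ z *ᵥ (P z - H z)) =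
      Sum.elim (fun _ => MvPolynomial.eval z p) (P z) := by
    intro z
    have h1 := congrArg (fun M => M *ᵥ fun α : Idx d N => monomialEval z α.1) hUF
    simp only [← Matrix.mulVec_mulVec] at h1
    have h2 : (F *ᵥ fun α : Idx d N => monomialEval z α.1) =
        Sum.elim (1 : Unit → ℂ) (diagOf τ z *ᵥ (P z - H z)) := by
      ext (i | i)
      · simp only [Matrix.mulVec, dotProduct, F, Matrix.of_apply, Sum.elim_inl, Pi.one_apply]
        rw [Finset.sum_eq_single ⟨0, by simp⟩]
        · simp [monomialEval]
        · intro α _ hα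
          rw [if_neg fun h0 => hα (Subtype.ext h0), zero_mul]
        · simp
      · rw [Sum.elim_inr, diagOf, Matrix.mulVec_diagonal]
        exact sum_shiftMat_mulVec_mul_monomialEval i.1 (a i.1 i.2) z
    have h3 : (G *ᵥ fun α : Idx d N => monomialEval z α.1) =
        Sum.elim (fun _ => MvPolynomial.eval z p) (P z) := by
      ext (i | i)
      · rw [Sum.elim_inl, eval_eq_sum_monomialEval hp]
        rfl
      · rfl
    rw [h2, h3] at h1
    exact h1
  have hden : ∀ᶠ z in 𝓝 (0 : Fin d → ℂ), MvPolynomial.eval z (transferDen τ D) ≠ 0 := by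
    refine (MvPolynomial.continuous_eval _).continuousAt.eventually_ne ?_
    rw [eval_transferDen_zero]
    exact one_ne_zero
  have hdiff : ∀ z : Fin d → ℂ, MvPolynomial.eval z (transferDen τ D) ≠ 0 →
      MvPolynomial.eval z p - transfer τ A b c D z =
        -∑ i, b () i * (z (τ i) * ∑ k, (1 - D * diagOf τ z)⁻¹ i k * H z k) := by
    intro z hz
    have hu : IsUnit (1 - D * diagOf τ z).det := by
      rw [← eval_transferDen]
      exact isUnit_iff_ne_zero.2 hz
    have h1 := congrArg₂ (· - ·) (hP z) (fromBlocks_mulVec_stateVec (A := A) (b := b) (c := c) τ hz)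
    simp only [← Matrix.mulVec_sub] at h1
    have h2 : (Sum.elim (1 : Unit → ℂ) (diagOf τ z *ᵥ (P z - H z)) -
        Sum.elim (1 : Unit → ℂ) (diagOf τ z *ᵥ stateVec τ c D z) : Unit ⊕ κ → ℂ) =
        Sum.elim (0 : Unit → ℂ) (diagOf τ z *ᵥ (P z - H z - stateVec τ c D z)) := by
      ext (i | i) <;> simp [Matrix.mulVec_sub]
    rw [h2, Matrix.fromBlocks_mulVec] at h1
    simp only [Sum.elim_comp_inl, Sum.elim_comp_inr, Matrix.mulVec_zero, zero_add] at h1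
    have h3 := congrFun h1 (Sum.inl ())
    have h4 : D *ᵥ (diagOf τ z *ᵥ (P z - H z - stateVec τ c D z)) = P z - stateVec τ c D z :=
      funext fun i => congrFun h1 (Sum.inr i)
    simp only [Pi.sub_apply, Sum.elim_inl] at h3
    have h5 : (1 - D * diagOf τ z) *ᵥ (P z - H z - stateVec τ c D z) = -H z := by
      rw [Matrix.sub_mulVec, Matrix.one_mulVec, ← Matrix.mulVec_mulVec, h4]
      abel
    have h6 : P z - H z - stateVec τ c D z = -((1 - D * diagOf τ z)⁻¹ *ᵥ H z) := by
      rw [← Matrix.mulVec_neg, ← h5, Matrix.mulVec_mulVec, Matrix.nonsing_inv_mul _ hu,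
        Matrix.one_mulVec]
    rw [← h3, h6, Matrix.mulVec_neg, Matrix.mulVec_neg, Pi.neg_apply]
    congr 1
    refine Finset.sum_congr rfl fun i _ => congrArg (b () i * ·) ?_
    exact Matrix.mulVec_diagonal _ _ _
  have hO : (fun z : Fin d → ℂ =>
      -∑ i, b () i * (z (τ i) * ∑ k, (1 - D * diagOf τ z)⁻¹ i k * H z k)) =O[𝓝 0]
      fun z => ‖z‖ ^ (N + 1) := by
    refine Asymptotics.IsBigO.neg_left (Asymptotics.IsBigO.fun_sum fun i _ => ?_)
    refine Asymptotics.IsBigO.const_mul_left ?_ _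
    have h1 : (fun z : Fin d → ℂ => z (τ i)) =O[𝓝 0] fun z => ‖z‖ :=
      Asymptotics.IsBigO.of_bound 1 (Eventually.of_forall fun z => by
        rw [one_mul, norm_norm]
        exact norm_le_pi_norm z _)
    have h2 : (fun z : Fin d → ℂ => ∑ k, (1 - D * diagOf τ z)⁻¹ i k * H z k) =O[𝓝 0]
        fun z => ‖z‖ ^ N := by
      refine Asymptotics.IsBigO.fun_sum fun k _ => ?_
      have h3 := (isBigO_inv_one_sub_apply (D := D) τ i k).mul (isBigO_topPart (a k.1 k.2))
      simpa only [one_mul] using h3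
    refine (h1.mul h2).congr_right fun z => ?_
    rw [pow_succ']
  refine hO.congr' ?_ EventuallyEq.rfl
  filter_upwards [hden] with z hz
  exact (hdiff z hz).symm

end Realization

end NilAgler

/-! ### The equivalence. -/

theorem theorem2 (d N : ℕ) (hd : 1 ≤ d) (p : MvPolynomial (Fin d) ℂ) (hp : p.totalDegree ≤ N) :
    List.TFAE [
      ∀ (n : ℕ) (T : Fin d → (NilAgler.Cn n →L[ℂ] NilAgler.Cn n)),
        NilAgler.IsSimpleNilpotent N T → (∀ j, ‖T j‖ ≤ 1) → ‖NilAgler.polyAt p T‖ ≤ 1,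
      ∃ A : Fin d → Matrix (NilAgler.Idx d N) (NilAgler.Idx d N) ℂ,
        (∀ j, (A j).PosSemidef) ∧
        ∀ α β : NilAgler.Idx d N,
          (if α.1 = 0 ∧ β.1 = 0 then 1 else 0) - starRingEnd ℂ (p.coeff α.1) * p.coeff β.1 =
            ∑ j, (A j α β - NilAgler.shift j (A j) α β),
      ∃ (m : Fin d → ℕ) (A : (j : Fin d) → Fin (m j) → MvPolynomial (Fin d) ℂ),
        (∀ j k, (A j k).totalDegree ≤ N) ∧
        (1 - NilAgler.absSq p) -
            ∑ j, (1 - NilAgler.absSq (MvPolynomial.X j)) * ∑ k, NilAgler.absSq (A j k) ∈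
          NilAgler.truncIdeal d N,
      ∃ φ : (Fin d → ℂ) → ℂ,
        NilAgler.IsRationalInner φ ∧
        NilAgler.VanishesToOrder (N + 1) (fun z => MvPolynomial.eval z p - φ z) ∧
        NilAgler.HasAglerDecomposition φ] := by
  -- Items 2 and 3 both become `HasMatrixDecomposition`, so their equivalence is `Iff.rfl`.
  rw [← NilAgler.hasMatrixDecomposition_iff, ← NilAgler.hasMatrixDecomposition_iff_mem_truncIdeal]
  tfae_have 1 → 2 := fun h => NilAgler.hasMatrixDecomposition_of_norm_polyAt_le_one hd hp h
  tfae_have 2 → 1 := fun h _ _ hT hT1 => NilAgler.norm_polyAt_le_one hp h hT hT1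
  tfae_have 2 ↔ 3 := Iff.rfl
  tfae_have 2 → 4 := NilAgler.exists_rationalInner hp
  tfae_have 4 → 2 := fun ⟨_, _, hφ, h⟩ => NilAgler.hasMatrixDecomposition_of_aglerDecomposition hφ h
  tfae_finish
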